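/- Let $c>1$ and $d>0$ be real numbers and let $a=d\,\mathbb 1_{[0,1]}$ on $(-1,1)$. Let $\mathcal H=(H^1_0(-1,1))^2\times(L^2(-1,1))^2$ be the (complex) energy space, with the norm $$\|(u^1,v^1,u^2,v^2)\|_{\mathcal H}^2=\int_{-1}^1\left(|u^1_x|^2+c\,|v^1_x|^2+|u^2|^2+|v^2|^2\right)dx ,$$ and let $\mathcal A$ be the operator on $\mathcal H$ given by $$\mathcal A(u^1,v^1,u^2,v^2)=\left(u^2,\;v^2,\;(u^1_x+a\,u^2_x)_x-v^2,\;c\,v^1_{xx}+u^2\right),$$ $$\mathcal D(\mathcal A)=\left\{(u^1,v^1,u^2,v^2)\in\mathcal H:\ u^2,v^2\in H^1_0(-1,1),\ v^1\in H^2(-1,1),\ (u^1_x+a\,u^2_x)_x\in L^2(-1,1)\right\}.$$ Assume that $\sin(2\sqrt c\,n\pi)$ is not $O(n^{-1/2})$ as $n\to\infty$, $n\in\mathbb N$. Then $\mathcal A$ generates a $C_0$-semigroup $(e^{t\mathcal A})_{t\ge 0}$ on $\mathcal H$, and this semigroup is not exponentially stable: there are no constants $M>0$ and $\alpha>0$ such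 that $\|e^{t\mathcal A}\|_{\mathcal L(\mathcal H)}\le M e^{-\alpha t}$ for all $t\ge 0$. -/

import Mathlib

open MeasureTheory Set Filter Topology Asymptotics
open scoped ContDiff NNReal

noncomputable section

namespace KVWave

/-- Lebesgue measure on the interval `(-1, 1)`. -/
abbrev mu : Measure ℝ := volume.restrict (Ioo (-1 : ℝ) 1)

/-- The complex Hilbert space `L²(-1, 1)`. -/
abbrev L2 : Type := Lp ℂ 2 mu

/-- `φ` is a (real) test function on `(-1, 1)`: an element of `C_c^∞(-1, 1)`. -/
def IsTest (φ : ℝ → ℝ) : Prop :=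
  ContDiff ℝ ∞ φ ∧ HasCompactSupport φ ∧ tsupport φ ⊆ Ioo (-1 : ℝ) 1

/-- `g` is the weak derivative of `f` on `(-1, 1)`. -/
def IsWeakDeriv (f g : L2) : Prop :=
  ∀ φ : ℝ → ℝ, IsTest φ → ∫ x, deriv φ x • f x ∂mu = -∫ x, φ x • g x ∂mu

theorem IsTest.deriv_test {φ : ℝ → ℝ} (h : IsTest φ) : IsTest (deriv φ) :=
  ⟨(contDiff_infty_iff_deriv.1 h.1).2, h.2.1.deriv, tsupport_deriv_subset.trans h.2.2⟩

theorem L2.integrable (f : L2) : Integrable f mu :=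
  (Lp.memLp f).integrable (by norm_num)

theorem IsTest.integrable_smul {φ : ℝ → ℝ} (h : IsTest φ) {f : ℝ → ℂ} (hf : Integrable f mu) :
    Integrable (fun x => φ x • f x) mu := by
  obtain ⟨C, hC⟩ := h.2.1.exists_bound_of_continuous h.1.continuous
  exact hf.bdd_smul C h.1.continuous.aestronglyMeasurable (Eventually.of_forall hC)

/-- A function which is orthogonal to all test functions vanishes. -/
theorem L2.eq_zero_of_test {f : ℝ → ℂ} (hf : Integrable f mu)
    (h : ∀ φ : ℝ → ℝ, IsTest φ → ∫ x, φ x • f x ∂mu = 0) : f =ᵐ[mu] 0 := by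
  have h2 := isOpen_Ioo.ae_eq_zero_of_integral_contDiff_smul_eq_zero (μ := (volume : Measure ℝ))
    (U := Ioo (-1 : ℝ) 1) (f := f) (IntegrableOn.locallyIntegrableOn hf) (by
      intro g g1 g2 g3
      have := h g ⟨g1, g2, g3⟩
      rw [← this]
      symm
      apply setIntegral_eq_integral_of_forall_compl_eq_zero
      intro x hx
      have : g x = 0 := image_eq_zero_of_notMem_tsupport (fun hh => hx (g3 hh))
      simp [this])
  exact (ae_restrict_iff' measurableSet_Ioo).2 h2

theorem IsWeakDeriv.unique {f g₁ g₂ : L2} (h₁ : IsWeakDeriv f g₁) (h₂ : IsWeakDeriv f g₂) :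
    g₁ = g₂ := by
  rw [← sub_eq_zero, Lp.eq_zero_iff_ae_eq_zero]
  apply L2.eq_zero_of_test (L2.integrable _)
  intro φ hφ
  have e : ∫ x, φ x • (g₁ - g₂ : L2) x ∂mu = ∫ x, (φ x • g₁ x - φ x • g₂ x) ∂mu := by
    apply integral_congr_ae
    filter_upwards [Lp.coeFn_sub g₁ g₂] with x hx
    rw [hx, Pi.sub_apply, smul_sub]
  rw [e, integral_sub (hφ.integrable_smul g₁.integrable) (hφ.integrable_smul g₂.integrable)]
  have := (h₁ φ hφ).symm.trans (h₂ φ hφ)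
  rw [neg_inj] at this
  rw [this, sub_self]

theorem IsWeakDeriv.add {f₁ f₂ g₁ g₂ : L2} (h₁ : IsWeakDeriv f₁ g₁) (h₂ : IsWeakDeriv f₂ g₂) :
    IsWeakDeriv (f₁ + f₂) (g₁ + g₂) := by
  intro φ hφ
  have e : ∀ (ψ : ℝ → ℝ) (_ : IsTest ψ) (a b : L2), ∫ x, ψ x • (a + b : L2) x ∂mu =
      ∫ x, ψ x • a x ∂mu + ∫ x, ψ x • b x ∂mu := by
    intro ψ hψ a b
    rw [← integral_add (hψ.integrable_smul a.integrable) (hψ.integrable_smul b.integrable)]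
    apply integral_congr_ae
    filter_upwards [Lp.coeFn_add a b] with x hx
    rw [hx, Pi.add_apply, smul_add]
  rw [e _ hφ.deriv_test, e _ hφ, h₁ φ hφ, h₂ φ hφ, neg_add]

theorem IsWeakDeriv.smul {f g : L2} (r : ℂ) (h : IsWeakDeriv f g) :
    IsWeakDeriv (r • f) (r • g) := by
  intro φ hφ
  have e : ∀ (ψ : ℝ → ℝ) (a : L2), ∫ x, ψ x • (r • a : L2) x ∂mu =
      r • ∫ x, ψ x • a x ∂mu := by
    intro ψ a
    rw [← integral_smul]
    apply integral_congr_ae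
    filter_upwards [Lp.coeFn_smul r a] with x hx
    rw [hx, Pi.smul_apply, smul_comm]
  rw [e, e, h φ hφ, smul_neg]

theorem IsWeakDeriv.zero : IsWeakDeriv 0 0 := by
  intro φ hφ
  have e : ∀ ψ : ℝ → ℝ, ∫ x, ψ x • (0 : L2) x ∂mu = 0 := by
    intro ψ
    rw [← integral_zero ℝ ℂ (μ := mu)]
    apply integral_congr_ae
    filter_upwards [Lp.coeFn_zero ℂ 2 mu] with x hx
    rw [hx, Pi.zero_apply, smul_zero]
  rw [e, e, neg_zero]

/-- The Sobolev space `H¹(-1, 1)`. -/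
def H1 : Submodule ℂ L2 where
  carrier := {f | ∃ g, IsWeakDeriv f g}
  add_mem' := by
    rintro _ _ ⟨g, hg⟩ ⟨k, hk⟩
    exact ⟨g + k, hg.add hk⟩
  zero_mem' := ⟨0, IsWeakDeriv.zero⟩
  smul_mem' := by
    rintro r _ ⟨g, hg⟩
    exact ⟨r • g, hg.smul r⟩

/-- The weak derivative `f ↦ f_x`, as a linear map from `H¹(-1, 1)` to `L²(-1, 1)`. -/
def weakDeriv : H1 →ₗ[ℂ] L2 where
  toFun f := f.2.choose
  map_add' f g := (f + g).2.choose_spec.unique (f.2.choose_spec.add g.2.choose_spec)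
  map_smul' r f := (r • f).2.choose_spec.unique (f.2.choose_spec.smul r)

theorem weakDeriv_spec (f : H1) : IsWeakDeriv f (weakDeriv f) := f.2.choose_spec

/-- The Sobolev space `H¹₀(-1, 1)`: the elements of `H¹(-1, 1)` whose continuous representative
on `[-1, 1]` vanishes at both end points. -/
def H10 : Submodule ℂ L2 where
  carrier := {f | f ∈ H1 ∧ ∃ F : ℝ → ℂ, ContinuousOn F (Icc (-1) 1) ∧ f =ᵐ[mu] F ∧
    F (-1) = 0 ∧ F 1 = 0}
  add_mem' := by
    rintro f g ⟨hf, F, F1, F2, F3, F4⟩ ⟨hg, G, G1, G2, G3, G4⟩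
    refine ⟨H1.add_mem hf hg, F + G, F1.add G1, (Lp.coeFn_add f g).trans (F2.add G2), ?_, ?_⟩
    · simp [F3, G3]
    · simp [F4, G4]
  zero_mem' := ⟨H1.zero_mem, 0, continuousOn_const, Lp.coeFn_zero ℂ 2 mu, rfl, rfl⟩
  smul_mem' := by
    rintro r f ⟨hf, F, F1, F2, F3, F4⟩
    refine ⟨H1.smul_mem r hf, r • F, F1.const_smul r,
      (Lp.coeFn_smul r f).trans (F2.const_smul r), ?_, ?_⟩
    · simp [F3]
    · simp [F4]

theorem H10_le_H1 : H10 ≤ H1 := fun _ h => h.1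

/-- The weak derivative on `H¹₀(-1, 1)`. -/
def weakDeriv₀ : H10 →ₗ[ℂ] L2 := weakDeriv ∘ₗ Submodule.inclusion H10_le_H1

/-- The primitive of a test function of integral zero is a test function. -/
theorem IsTest.exists_primitive {χ : ℝ → ℝ} (h : IsTest χ) (h0 : ∫ x, χ x = 0) :
    ∃ φ, IsTest φ ∧ deriv φ = χ := by
  have hd : ∀ x, HasDerivAt (fun x => ∫ t in (-1 : ℝ)..x, χ t) (χ x) x := fun x =>
    intervalIntegral.integral_hasDerivAt_right (h.1.continuous.intervalIntegrable _ _)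
      (h.1.continuous.stronglyMeasurableAtFilter _ _) h.1.continuous.continuousAt
  have hdd : deriv (fun x => ∫ t in (-1 : ℝ)..x, χ t) = χ := funext fun x => (hd x).deriv
  -- the support of `χ` lies in some `[a, b] ⊆ (-1, 1)`
  obtain ⟨a, b, ha, hb, hab⟩ : ∃ a b : ℝ, -1 < a ∧ b < 1 ∧ tsupport χ ⊆ Icc a b := by
    rcases (tsupport χ).eq_empty_or_nonempty with he | hne
    · exact ⟨0, 0, by norm_num, by norm_num, by simp [he]⟩
    · have hc : IsCompact (tsupport χ) := h.2.1
      obtain ⟨a, ha, ha'⟩ := hc.exists_isLeast hne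
      obtain ⟨b, hb, hb'⟩ := hc.exists_isGreatest hne
      exact ⟨a, b, (h.2.2 ha).1, (h.2.2 hb).2, fun x hx => ⟨ha' hx, hb' hx⟩⟩
  have hz : ∀ x, x ∉ Icc a b → χ x = 0 := fun x hx =>
    image_eq_zero_of_notMem_tsupport fun hh => hx (hab hh)
  have hsupp : Function.support (fun x => ∫ t in (-1 : ℝ)..x, χ t) ⊆ Icc a b := by
    intro x hx
    by_contra hxn
    apply hx
    change ∫ t in (-1 : ℝ)..x, χ t = 0
    rw [mem_Icc, not_and_or, not_le, not_le] at hxn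
    rcases hxn with hxa | hxb
    · apply intervalIntegral.integral_zero_ae
      refine Eventually.of_forall fun t ht => hz t fun htt => ?_
      rcases le_max_iff.1 ht.2 with h1 | h1 <;> linarith [htt.1]
    · rw [← h0]
      apply intervalIntegral.integral_eq_integral_of_support_subset
      intro t ht
      have : t ∈ Icc a b := by
        by_contra hh
        exact ht (hz t hh)
      exact ⟨by linarith [this.1], by linarith [this.2]⟩
  have hts : tsupport (fun x => ∫ t in (-1 : ℝ)..x, χ t) ⊆ Icc a b :=
    closure_minimal hsupp isClosed_Icc
  refine ⟨_, ⟨?_, ?_, ?_⟩, hdd⟩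
  · rw [contDiff_infty_iff_deriv, hdd]
    exact ⟨fun x => (hd x).differentiableAt, h.1⟩
  · exact HasCompactSupport.of_support_subset_isCompact isCompact_Icc hsupp
  · exact hts.trans fun x hx => ⟨by linarith [hx.1], by linarith [hx.2]⟩

theorem exists_isTest_integral_one : ∃ ρ : ℝ → ℝ, IsTest ρ ∧ ∫ x, ρ x = 1 := by
  let b : ContDiffBump (0 : ℝ) := ⟨1 / 4, 1 / 2, by norm_num, by norm_num⟩
  refine ⟨b.normed volume, ⟨b.contDiff_normed, b.hasCompactSupport_normed, ?_⟩,
    b.integral_normed⟩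
  rw [b.tsupport_normed_eq, Real.closedBall_eq_Icc]
  intro x hx
  have h1 : b.rOut = 1 / 2 := rfl
  rw [h1] at hx
  exact ⟨by linarith [hx.1], by linarith [hx.2]⟩

/-- A function with vanishing weak derivative is constant. -/
theorem IsWeakDeriv.const_of_zero {f : L2} (h : IsWeakDeriv f 0) :
    ∃ C : ℂ, f =ᵐ[mu] fun _ => C := by
  obtain ⟨ρ, hρ, hρ1⟩ := exists_isTest_integral_one
  have h0 : ∀ φ : ℝ → ℝ, IsTest φ → ∫ x, deriv φ x • f x ∂mu = 0 := by
    intro φ hφ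
    rw [h φ hφ, neg_eq_zero, ← integral_zero ℝ ℂ (μ := mu)]
    apply integral_congr_ae
    filter_upwards [Lp.coeFn_zero ℂ 2 mu] with x hx
    rw [hx, Pi.zero_apply, smul_zero]
  refine ⟨∫ x, ρ x • f x ∂mu, ?_⟩
  set C : ℂ := ∫ x, ρ x • f x ∂mu with hC
  have hi : Integrable (fun x => f x - C) mu := f.integrable.sub (integrable_const C)
  have key : (fun x => f x - C) =ᵐ[mu] 0 := by
    apply L2.eq_zero_of_test hi
    intro ψ hψ
    have iρ : Integrable ρ := hρ.1.continuous.integrable_of_hasCompactSupport hρ.2.1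
    have iψ : Integrable ψ := hψ.1.continuous.integrable_of_hasCompactSupport hψ.2.1
    have hχ : IsTest (fun x => ψ x - (∫ t, ψ t) * ρ x) := by
      refine ⟨hψ.1.sub (contDiff_const.mul hρ.1), hψ.2.1.sub hρ.2.1.mul_left, ?_⟩
      refine (tsupport_sub ψ (fun x => (∫ t, ψ t) * ρ x)).trans (union_subset hψ.2.2 ?_)
      exact (tsupport_mul_subset_right (f := fun _ => ∫ t, ψ t) (g := ρ)).trans hρ.2.2
    obtain ⟨φ, hφ, hφd⟩ := hχ.exists_primitive (by
      rw [integral_sub iψ (iρ.const_mul _), integral_const_mul, hρ1, mul_one, sub_self])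
    have e1 := h0 φ hφ
    rw [hφd] at e1
    have e2 : ∫ x, ψ x ∂mu = ∫ x, ψ x :=
      setIntegral_eq_integral_of_forall_compl_eq_zero fun x hx =>
        image_eq_zero_of_notMem_tsupport fun hh => hx (hψ.2.2 hh)
    have e3 : ∫ x, (ψ x - (∫ t, ψ t) * ρ x) • f x ∂mu =
        ∫ x, ψ x • f x ∂mu - (∫ t, ψ t) • C := by
      have i2 : Integrable (fun x => (∫ t, ψ t) • ρ x • f x) mu :=
        (hρ.integrable_smul f.integrable).smul (∫ t, ψ t)
      rw [hC, ← integral_smul, ← integral_sub (hψ.integrable_smul f.integrable) i2]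
      congr 1
      funext x
      rw [sub_smul, mul_smul]
    rw [e3] at e1
    have e4 : ∫ x, ψ x • (f x - C) ∂mu = ∫ x, ψ x • f x ∂mu - (∫ t, ψ t) • C := by
      rw [← e2, ← integral_smul_const, ← integral_sub (hψ.integrable_smul f.integrable)
        (iψ.restrict.smul_const C)]
      simp_rw [smul_sub]
    rw [e4, e1]
  filter_upwards [key] with x hx
  exact sub_eq_zero.1 hx

theorem weakDeriv₀_injective : Function.Injective weakDeriv₀ := by
  rw [injective_iff_map_eq_zero]
  rintro ⟨f, hf, F, F1, F2, _, F4⟩ h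
  have hw : IsWeakDeriv f 0 := by
    have := weakDeriv_spec ⟨f, hf⟩
    rwa [show weakDeriv ⟨f, hf⟩ = 0 from h] at this
  obtain ⟨C, hC⟩ := hw.const_of_zero
  have hFC : F =ᵐ[mu] fun _ => C := F2.symm.trans hC
  have hEq : EqOn F (fun _ => C) (Icc (-1) 1) := by
    have h1 : F =ᵐ[volume.restrict (Icc (-1 : ℝ) 1)] fun _ => C := by
      rwa [Measure.restrict_congr_set Ioo_ae_eq_Icc.symm]
    exact Measure.eqOn_Icc_of_ae_eq volume (by norm_num) h1 F1 continuousOn_const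
  have hC0 : C = 0 := by
    rw [← F4]
    exact (hEq ⟨by norm_num, le_rfl⟩).symm
  apply Subtype.ext
  change f = 0
  rw [Lp.eq_zero_iff_ae_eq_zero]
  rw [hC0] at hC
  exact hC

/-- The parameters of the system: the squared speed `c > 0` of the second wave and the strength
`d > 0` of the damping of the first one. -/
structure Params where
  c : ℝ
  d : ℝ
  c_pos : 0 < c
  d_pos : 0 < d

/-- Multiplication by the damping coefficient `a = d 𝟙_{[0,1]}` on `L²(-1, 1)`. -/
def dampMul (p : Params) : L2 →ₗ[ℂ] L2 where
  toFun f := (p.d : ℂ) • (((Lp.memLp f).indicator (s := Icc (0 : ℝ) 1) measurableSet_Icc).toLp _)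
  map_add' f g := by
    rw [← smul_add, ← MemLp.toLp_add]
    congr 1
    apply MemLp.toLp_congr
    filter_upwards [Lp.coeFn_add f g] with x hx
    rw [Pi.add_apply] at hx ⊢
    by_cases h : x ∈ Icc (0 : ℝ) 1
    · simp only [indicator_of_mem h, hx]
    · simp only [indicator_of_notMem h, add_zero]
  map_smul' r f := by
    rw [RingHom.id_apply, smul_comm r]
    refine congrArg (fun k : L2 => (p.d : ℂ) • k) ?_
    rw [← MemLp.toLp_const_smul]
    apply MemLp.toLp_congr
    filter_upwards [Lp.coeFn_smul r f] with x hx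
    rw [Pi.smul_apply] at hx ⊢
    by_cases h : x ∈ Icc (0 : ℝ) 1
    · simp only [indicator_of_mem h, hx]
    · simp only [indicator_of_notMem h, smul_zero]

theorem dampMul_coeFn (p : Params) (f : L2) :
    dampMul p f =ᵐ[mu] fun x => (Icc (0 : ℝ) 1).indicator (fun _ => (p.d : ℂ)) x * f x := by
  filter_upwards [Lp.coeFn_smul (p.d : ℂ)
    (((Lp.memLp f).indicator (s := Icc (0 : ℝ) 1) measurableSet_Icc).toLp _),
    ((Lp.memLp f).indicator (s := Icc (0 : ℝ) 1) measurableSet_Icc).coeFn_toLp] with x h1 h2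
  change ((p.d : ℂ) • (((Lp.memLp f).indicator (s := Icc (0 : ℝ) 1)
    measurableSet_Icc).toLp _) : L2) x = _
  rw [h1, Pi.smul_apply, h2]
  by_cases h : x ∈ Icc (0 : ℝ) 1 <;> simp [h]

/-- The vector space underlying the energy space: `H¹₀ × H¹₀ × L² × L²` over `(-1, 1)`. It is
given its own name because it carries the energy inner product and not the product norm. -/
def Energy (_ : Params) : Type := H10 × H10 × L2 × L2

namespace Energy

variable {p : Params}

instance : AddCommGroup (Energy p) := inferInstanceAs (AddCommGroup (H10 × H10 × L2 × L2))

instance : Module ℂ (Energy p) := inferInstanceAs (Module ℂ (H10 × H10 × L2 × L2))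

/-- The four components of `y = (u¹, v¹, u², v²)`, as linear maps. -/
def u1 : Energy p →ₗ[ℂ] H10 := LinearMap.fst ℂ H10 (H10 × L2 × L2)

def v1 : Energy p →ₗ[ℂ] H10 :=
  LinearMap.fst ℂ H10 (L2 × L2) ∘ₗ LinearMap.snd ℂ H10 (H10 × L2 × L2)

def u2 : Energy p →ₗ[ℂ] L2 :=
  LinearMap.fst ℂ L2 L2 ∘ₗ LinearMap.snd ℂ H10 (L2 × L2) ∘ₗ LinearMap.snd ℂ H10 (H10 × L2 × L2)

def v2 : Energy p →ₗ[ℂ] L2 :=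
  LinearMap.snd ℂ L2 L2 ∘ₗ LinearMap.snd ℂ H10 (L2 × L2) ∘ₗ LinearMap.snd ℂ H10 (H10 × L2 × L2)

/-- The vector of the energy space with the given four components. -/
def ofComponents : (H10 × H10 × L2 × L2) →ₗ[ℂ] Energy p where
  toFun x := x
  map_add' _ _ := rfl
  map_smul' _ _ := rfl

theorem ext {x y : Energy p} (h1 : u1 x = u1 y) (h2 : v1 x = v1 y) (h3 : u2 x = u2 y)
    (h4 : v2 x = v2 y) : x = y :=
  Prod.ext h1 (Prod.ext h2 (Prod.ext h3 h4))

/-- The energy inner product. -/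
@[reducible]
def innerCore : InnerProductSpace.Core ℂ (Energy p) where
  inner x y := inner ℂ (weakDeriv₀ (u1 x)) (weakDeriv₀ (u1 y)) +
    (p.c : ℂ) * inner ℂ (weakDeriv₀ (v1 x)) (weakDeriv₀ (v1 y)) +
    inner ℂ (u2 x) (u2 y) + inner ℂ (v2 x) (v2 y)
  conj_inner_symm x y := by
    simp only [map_add, map_mul, inner_conj_symm, Complex.conj_ofReal]
  re_inner_nonneg x := by
    simp only [inner_self_eq_norm_sq_to_K, Complex.coe_algebraMap, ← Complex.ofReal_pow,
      ← Complex.ofReal_mul, ← Complex.ofReal_add]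
    rw [RCLike.re_eq_complex_re, Complex.ofReal_re]
    have := p.c_pos.le
    positivity
  add_left x y z := by
    simp only [map_add, inner_add_left]
    ring
  smul_left x y r := by
    simp only [map_smul, inner_smul_left]
    ring
  definite x hx := by
    simp only [inner_self_eq_norm_sq_to_K, Complex.coe_algebraMap, ← Complex.ofReal_pow,
      ← Complex.ofReal_mul, ← Complex.ofReal_add] at hx
    rw [Complex.ofReal_eq_zero] at hx
    have hc := p.c_pos
    have h1 := sq_nonneg ‖weakDeriv₀ (u1 x)‖
    have h2 := mul_nonneg hc.le (sq_nonneg ‖weakDeriv₀ (v1 x)‖)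
    have h3 := sq_nonneg ‖u2 x‖
    have h4 := sq_nonneg ‖v2 x‖
    have k1 : ‖weakDeriv₀ (u1 x)‖ ^ 2 = 0 := by linarith
    have k2 : p.c * ‖weakDeriv₀ (v1 x)‖ ^ 2 = 0 := by linarith
    have k3 : ‖u2 x‖ ^ 2 = 0 := by linarith
    have k4 : ‖v2 x‖ ^ 2 = 0 := by linarith
    replace k2 := (mul_eq_zero.1 k2).resolve_left hc.ne'
    rw [sq_eq_zero_iff, norm_eq_zero] at k1 k2 k3 k4
    apply Energy.ext
    · exact (weakDeriv₀_injective (k1.trans (map_zero _).symm)).trans (map_zero u1).symm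
    · exact (weakDeriv₀_injective (k2.trans (map_zero _).symm)).trans (map_zero v1).symm
    · exact k3.trans (map_zero u2).symm
    · exact k4.trans (map_zero v2).symm

instance : NormedAddCommGroup (Energy p) := innerCore.toNormedAddCommGroup

instance : InnerProductSpace ℂ (Energy p) := InnerProductSpace.ofCore innerCore.toCore

end Energy

/-- The domain `D(𝒜)`: all `(u¹, v¹, u², v²)` in the energy space such that `u²` and `v²` belong to
`H¹₀`, `v¹` belongs to `H²` (that is, `v¹ₓ ∈ H¹`) and `(u¹ₓ + a u²ₓ)ₓ` belongs to `L²` (that is,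
`u¹ₓ + a u²ₓ ∈ H¹`). -/
def waveDomain (p : Params) : Submodule ℂ (Energy p) where
  carrier := {y | ∃ (h : Energy.u2 y ∈ H10), Energy.v2 y ∈ H10 ∧
    weakDeriv₀ (Energy.v1 y) ∈ H1 ∧
    weakDeriv₀ (Energy.u1 y) + dampMul p (weakDeriv₀ ⟨Energy.u2 y, h⟩) ∈ H1}
  add_mem' := by
    rintro x y ⟨x1, x2, x3, x4⟩ ⟨y1, y2, y3, y4⟩
    refine ⟨by rw [map_add]; exact H10.add_mem x1 y1, by rw [map_add]; exact H10.add_mem x2 y2,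
      by rw [map_add, map_add]; exact H1.add_mem x3 y3, ?_⟩
    convert H1.add_mem x4 y4 using 1
    have e : (⟨Energy.u2 (x + y), by rw [map_add]; exact H10.add_mem x1 y1⟩ : H10) =
        ⟨Energy.u2 x, x1⟩ + ⟨Energy.u2 y, y1⟩ := Subtype.ext (map_add _ _ _)
    rw [e]
    simp only [map_add]
    abel
  zero_mem' := by
    refine ⟨by rw [map_zero]; exact H10.zero_mem, by rw [map_zero]; exact H10.zero_mem,
      by rw [map_zero, map_zero]; exact H1.zero_mem, ?_⟩
    have e : (⟨Energy.u2 (0 : Energy p), by rw [map_zero]; exact H10.zero_mem⟩ : H10) = 0 :=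
      Subtype.ext (map_zero _)
    rw [e]
    simp only [map_zero, add_zero]
    exact H1.zero_mem
  smul_mem' := by
    rintro r x ⟨x1, x2, x3, x4⟩
    refine ⟨by rw [map_smul]; exact H10.smul_mem r x1, by rw [map_smul]; exact H10.smul_mem r x2,
      by rw [map_smul, map_smul]; exact H1.smul_mem r x3, ?_⟩
    convert H1.smul_mem r x4 using 1
    have e : (⟨Energy.u2 (r • x), by rw [map_smul]; exact H10.smul_mem r x1⟩ : H10) =
        r • ⟨Energy.u2 x, x1⟩ := Subtype.ext (map_smul _ _ _)
    rw [e]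
    simp only [map_smul, smul_add]

section components

variable {p : Params}

/-- `u²` as an element of `H¹₀`, for `y ∈ D(𝒜)`. -/
def domU2 : waveDomain p →ₗ[ℂ] H10 :=
  LinearMap.codRestrict H10 (Energy.u2 ∘ₗ (waveDomain p).subtype) fun y => y.2.choose

/-- `v²` as an element of `H¹₀`, for `y ∈ D(𝒜)`. -/
def domV2 : waveDomain p →ₗ[ℂ] H10 :=
  LinearMap.codRestrict H10 (Energy.v2 ∘ₗ (waveDomain p).subtype) fun y => y.2.choose_spec.1

/-- `v¹ₓ` as an element of `H¹`, for `y ∈ D(𝒜)`. -/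
def domV1x : waveDomain p →ₗ[ℂ] H1 :=
  LinearMap.codRestrict H1 (weakDeriv₀ ∘ₗ Energy.v1 ∘ₗ (waveDomain p).subtype)
    fun y => y.2.choose_spec.2.1

/-- The flux `u¹ₓ + a u²ₓ` as an element of `H¹`, for `y ∈ D(𝒜)`. -/
def domFlux : waveDomain p →ₗ[ℂ] H1 :=
  LinearMap.codRestrict H1
    (weakDeriv₀ ∘ₗ Energy.u1 ∘ₗ (waveDomain p).subtype + dampMul p ∘ₗ weakDeriv₀ ∘ₗ domU2)
    fun y => y.2.choose_spec.2.2

end components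

/-- The operator `𝒜 (u¹, v¹, u², v²) = (u², v², (u¹ₓ + a u²ₓ)ₓ - v², c v¹ₓₓ + u²)`. -/
def waveOp (p : Params) : Energy p →ₗ.[ℂ] Energy p where
  domain := waveDomain p
  toFun := Energy.ofComponents ∘ₗ LinearMap.prod domU2 (LinearMap.prod domV2 (LinearMap.prod
    (weakDeriv ∘ₗ domFlux - Energy.v2 ∘ₗ (waveDomain p).subtype)
    ((p.c : ℂ) • (weakDeriv ∘ₗ domV1x) + Energy.u2 ∘ₗ (waveDomain p).subtype)))

/-- A `C₀`-semigroup of bounded linear operators on a normed space. -/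
structure C0Semigroup (X : Type*) [NormedAddCommGroup X] [NormedSpace ℂ X] where
  T : ℝ≥0 → X →L[ℂ] X
  map_zero : T 0 = ContinuousLinearMap.id ℂ X
  map_add : ∀ s t, T (s + t) = (T s).comp (T t)
  tendsto_zero : ∀ x, Tendsto (fun t => T t x) (𝓝 0) (𝓝 x)

/-- `A` is the infinitesimal generator of `S`: one has `x ∈ D(A)` and `A x = y` if and only if
`(S(t) x - x) / t → y` as `t → 0⁺`. -/
def C0Semigroup.HasGenerator {X : Type*} [NormedAddCommGroup X] [NormedSpace ℂ X]
    (S : C0Semigroup X) (A : X →ₗ.[ℂ] X) : Prop :=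
  ∀ x y : X, (x, y) ∈ A.graph ↔
    Tendsto (fun t : ℝ≥0 => (t : ℝ)⁻¹ • (S.T t x - x)) (𝓝[>] 0) (𝓝 y)

/-- Exponential stability: `‖S(t)‖ ≤ M e^{-αt}` for all `t ≥ 0`, for some `M, α > 0`. -/
def C0Semigroup.ExpStable {X : Type*} [NormedAddCommGroup X] [NormedSpace ℂ X]
    (S : C0Semigroup X) : Prop :=
  ∃ M > 0, ∃ α > 0, ∀ t : ℝ≥0, ‖S.T t‖ ≤ M * Real.exp (-α * t)

end KVWave

end

/-! Generation. `𝒜` is dissipative: the elastic and coupling terms cancel in `Re ⟨y, 𝒜 y⟩`, and only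
the damping remains. It also has a bounded everywhere defined inverse `G`, found by integrating the
equations (`waveInv`). Hence `G` is dissipative and injective, so it has dense range. The bounded
operators `B_ε = (G - ε)⁻¹` are dissipative, commute with one another, and satisfy `B_ε G w → w`.
The contractions `exp (t B_ε)` converge on the range of `G` by Duhamel's formula, hence everywhere,
and the limit is a semigroup with generator `𝒜` (`exists_semigroup_of_dissipative`).

Instability. Exponential stability forces `‖y‖ ≤ K ‖(𝒜 - i l) y‖` with one constant `K` for all real
`l` (`C0Semigroup.ExpStable.exists_norm_le`). Let `k = 2nπ` and `l = √c k`, so that `sin (k x)` is a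
Dirichlet eigenfunction of the second wave at frequency `l`. Put `v = sin (k x) / l` and let `u` be
the response of the first, damped wave to this forcing. Then `y = (u, v, i l u, i l v)` has norm at
least `1`, and the only term left in `(𝒜 - i l) y` is `i l u`, in the last component
(`exists_approximate_eigenvector`). It remains to see that `l u` is small.

The response is explicit. With `D = 1 + i l d` and `D μ² = -l²`, it is `β sin (k x) + α sin (l (x +
1))` on `[-1, 0]` and `γ sin (k x) + δ sinh (μ (1 - x))` on `[0, 1]`. Since `c > 1`, the number `l²
- k² = (c - 1) k²` is of order `k²`, so `β` and `γ` are `O(k⁻²)`. The transmission conditions at `0`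
give `α = O(k⁻¹) / T`, where `T` is their determinant. At high frequency the damped half behaves
almost like a rigid wall: `|D μ|` is at least of order `l^{3/2}`. Therefore `|T| ≥ l` unless `l` is
near a resonance `sin l = 0` of the interval `[-1, 0]`, precisely unless `√(l d) |sin l| < 4`
(`norm_transmission_ge`). Away from resonance `l u = O(k⁻¹)`, which contradicts the resolvent bound
for large `n`. So exponential stability implies `sin (2√c nπ) = O(n^{-1/2})`, which the hypothesis
excludes. -/

noncomputable section

namespace KVWave

/-! ### Bounded dissipative operators, their exponentials and Yosida approximations -/

section Hilbert

variable {H : Type*} [NormedAddCommGroup H] [InnerProductSpace ℂ H]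

theorem norm_le_of_coercive {T : H →L[ℂ] H} {ε : ℝ}
    (h : ∀ x, ε * ‖x‖ ^ 2 ≤ (inner ℂ (T x) x).re) (x : H) : ε * ‖x‖ ≤ ‖T x‖ := by
  rcases eq_or_ne x 0 with rfl | hx
  · simp
  · have h1 : (inner ℂ (T x) x).re ≤ ‖T x‖ * ‖x‖ := re_inner_le_norm (𝕜 := ℂ) (T x) x
    have h2 := h x
    have h3 : 0 < ‖x‖ := norm_pos_iff.2 hx
    have : (ε * ‖x‖) * ‖x‖ ≤ ‖T x‖ * ‖x‖ := by nlinarith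
    exact le_of_mul_le_mul_right this h3

/-- A coercive bounded operator on a complex Hilbert space is invertible. -/
theorem exists_inverse_of_coercive [CompleteSpace H] {T : H →L[ℂ] H} {ε : ℝ} (hε : 0 < ε)
    (h : ∀ x, ε * ‖x‖ ^ 2 ≤ (inner ℂ (T x) x).re) :
    ∃ R : H →L[ℂ] H, (∀ x, T (R x) = x) ∧ ∀ x, R (T x) = x := by
  have hb := norm_le_of_coercive h
  have hal : AntilipschitzWith (ε⁻¹.toNNReal) T := by
    apply ContinuousLinearMap.antilipschitz_of_bound
    intro x
    rw [Real.coe_toNNReal _ (inv_pos.2 hε).le, ← div_eq_inv_mul, le_div_iff₀ hε, mul_comm]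
    exact hb x
  have hker : T.ker = ⊥ := LinearMap.ker_eq_bot.2 hal.injective
  have hcl : IsClosed (T.range : Set H) := hal.isClosed_range T.uniformContinuous
  have hrange : T.range = ⊤ := by
    have := hcl.completeSpace_coe
    -- The range is closed, so it suffices that its orthogonal complement is zero. Coercivity tested
    -- on `w ⊥ T w` gives `w = 0`.
    rw [← T.range.orthogonal_orthogonal, Submodule.eq_top_iff']
    intro v w hw
    have h0 : inner ℂ (T w) w = 0 := hw _ ⟨w, rfl⟩
    have h1 := h w
    rw [h0, Complex.zero_re] at h1
    have h2 : ‖w‖ ^ 2 = 0 := by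
      have := sq_nonneg ‖w‖
      nlinarith
    rw [sq_eq_zero_iff, norm_eq_zero] at h2
    rw [h2, inner_zero_left]
  let e := ContinuousLinearEquiv.ofBijective T hker hrange
  exact ⟨e.symm, fun x => e.apply_symm_apply x, fun x => e.symm_apply_apply x⟩

theorem hasDerivAt_exp_smul_apply [CompleteSpace H] (B : H →L[ℂ] H) (x : H) (t : ℝ) :
    HasDerivAt (fun s : ℝ => NormedSpace.exp (s • B) x) (NormedSpace.exp (t • B) (B x)) t := by
  have h := hasDerivAt_exp_smul_const (𝕂 := ℝ) B t
  have h2 := ((ContinuousLinearMap.apply ℂ H x).restrictScalars ℝ).hasFDerivAt.comp_hasDerivAt t h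
  exact h2

theorem exp_smul_comm_apply [CompleteSpace H] {B C : H →L[ℂ] H} (h : Commute B C) (t : ℝ) (x : H) :
    NormedSpace.exp (t • B) (C x) = C (NormedSpace.exp (t • B) x) := by
  have := ((h.smul_left t).exp_left (𝔸 := H →L[ℂ] H)).eq
  exact congrArg (fun L : H →L[ℂ] H => L x) this

/-- A bounded dissipative operator generates a group which is contractive for positive times. -/
theorem norm_exp_smul_apply_le [CompleteSpace H] {B : H →L[ℂ] H}
    (hB : ∀ x, (inner ℂ (B x) x).re ≤ 0) {t : ℝ} (ht : 0 ≤ t) (x : H) :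
    ‖NormedSpace.exp (t • B) x‖ ≤ ‖x‖ := by
  let _ : InnerProductSpace ℝ H := InnerProductSpace.rclikeToReal ℂ H
  have hd : ∀ s : ℝ, HasDerivAt (fun s : ℝ => ‖NormedSpace.exp (s • B) x‖ ^ 2)
      (2 * inner ℝ (NormedSpace.exp (s • B) x) (NormedSpace.exp (s • B) (B x))) s :=
    fun s => (hasDerivAt_exp_smul_apply B x s).norm_sq
  have hanti : Antitone (fun s : ℝ => ‖NormedSpace.exp (s • B) x‖ ^ 2) := by
    apply antitone_of_deriv_nonpos (fun s => (hd s).differentiableAt)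
    intro s
    rw [(hd s).deriv, exp_smul_comm_apply (Commute.refl B)]
    have h1 := hB (NormedSpace.exp (s • B) x)
    have h2 : inner ℝ (NormedSpace.exp (s • B) x) (B (NormedSpace.exp (s • B) x)) =
        (inner ℂ (B (NormedSpace.exp (s • B) x)) (NormedSpace.exp (s • B) x)).re := by
      rw [real_inner_comm]
      rfl
    rw [h2]
    linarith
  have h := hanti ht
  simp only [zero_smul, NormedSpace.exp_zero, one_apply_eq_self] at h
  exact (pow_le_pow_iff_left₀ (norm_nonneg _) (norm_nonneg _) two_ne_zero).1 h

/-- Two groups generated by commuting bounded dissipative operators are close if their generators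
are. -/
theorem norm_exp_smul_sub_exp_smul_le [CompleteSpace H] {B C : H →L[ℂ] H} (hBC : Commute B C)
    (hB : ∀ x, (inner ℂ (B x) x).re ≤ 0) (hC : ∀ x, (inner ℂ (C x) x).re ≤ 0)
    {t : ℝ} (ht : 0 ≤ t) (x : H) :
    ‖NormedSpace.exp (t • B) x - NormedSpace.exp (t • C) x‖ ≤ t * ‖B x - C x‖ := by
  -- Duhamel interpolation between `exp (t C) x` at `s = 0` and `exp (t B) x` at `s = t`.
  -- Commutation collects the derivative into `B x - C x` behind two contractions.
  have hd : ∀ s : ℝ, HasDerivAt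
      (fun s : ℝ => NormedSpace.exp (s • B) (NormedSpace.exp ((t - s) • C) x))
      (NormedSpace.exp (s • B) (NormedSpace.exp ((t - s) • C) (B x - C x))) s := by
    intro s
    have h1 := hasDerivAt_exp_smul_const (𝕂 := ℝ) B s
    have h2 : HasDerivAt (fun s : ℝ => NormedSpace.exp ((t - s) • C) x)
        ((-1 : ℝ) • NormedSpace.exp ((t - s) • C) (C x)) s := by
      have := (hasDerivAt_exp_smul_apply C x (t - s)).scomp s ((hasDerivAt_id s).const_sub t)
      exact this
    have h3 : HasDerivAt (fun s : ℝ => (NormedSpace.exp (s • B)).restrictScalars ℝ)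
        ((NormedSpace.exp (s • B) * B).restrictScalars ℝ) s :=
      (ContinuousLinearMap.restrictScalarsL ℂ H H ℝ ℝ).hasFDerivAt.comp_hasDerivAt s h1
    have h4 := h3.clm_apply h2
    have e : NormedSpace.exp (s • B) (NormedSpace.exp ((t - s) • C) (B x - C x)) =
        NormedSpace.exp (s • B) (B (NormedSpace.exp ((t - s) • C) x)) +
          NormedSpace.exp (s • B) ((-1 : ℝ) • NormedSpace.exp ((t - s) • C) (C x)) := by
      rw [neg_one_smul, map_neg, map_sub, map_sub, sub_eq_add_neg, exp_smul_comm_apply hBC.symm]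
    rw [e]
    exact h4
  have h := norm_image_sub_le_of_norm_deriv_le_segment' (a := 0) (b := t) (C := ‖B x - C x‖)
    (fun s _ => (hd s).hasDerivWithinAt) (fun s hs =>
      (norm_exp_smul_apply_le hB hs.1 _).trans (norm_exp_smul_apply_le hC (by linarith [hs.2]) _))
      t ⟨ht, le_rfl⟩
  simpa [mul_comm] using h

/-- If `x` is orthogonal to the range, dissipativity tested on `x + t G x` leaves `‖G x‖² + t Re ⟨G
G x, G x⟩ ≤ 0` for `t > 0`. Letting `t → 0` gives `G x = 0`. -/
theorem dense_range_of_dissipative [CompleteSpace H] {G : H →L[ℂ] H}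
    (hG : ∀ x, (inner ℂ (G x) x).re ≤ 0) (hinj : ∀ x, G x = 0 → x = 0) :
    DenseRange G := by
  have h : (G.range : Submodule ℂ H).topologicalClosure = ⊤ := by
    rw [Submodule.topologicalClosure_eq_top_iff, Submodule.eq_bot_iff]
    intro x hx
    apply hinj
    have hx' : ∀ y, inner ℂ (G y) x = 0 := fun y => hx _ ⟨y, rfl⟩
    have key : ∀ t : ℝ, 0 < t → ‖G x‖ ^ 2 + t * (inner ℂ (G (G x)) (G x)).re ≤ 0 := by
      intro t ht
      have h1 := hG (x + (t : ℂ) • G x)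
      have h2 : (inner ℂ (G (x + (t : ℂ) • G x)) (x + (t : ℂ) • G x)).re =
          t * (‖G x‖ ^ 2 + t * (inner ℂ (G (G x)) (G x)).re) := by
        rw [inner_add_right, hx', zero_add, inner_smul_right, map_add, map_smul, inner_add_left,
          inner_smul_left, Complex.conj_ofReal, inner_self_eq_norm_sq_to_K, Complex.re_ofReal_mul,
          Complex.add_re, Complex.re_ofReal_mul]
        norm_cast
      rw [h2] at h1
      exact nonpos_of_mul_nonpos_right h1 ht
    have hlim : Tendsto (fun t : ℝ => ‖G x‖ ^ 2 + t * (inner ℂ (G (G x)) (G x)).re) (𝓝[>] 0)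
        (𝓝 (‖G x‖ ^ 2 + 0 * (inner ℂ (G (G x)) (G x)).re)) := by
      apply Tendsto.mono_left _ nhdsWithin_le_nhds
      exact Continuous.tendsto (by fun_prop) 0
    have h0 := le_of_tendsto hlim (eventually_nhdsWithin_of_forall key)
    rw [zero_mul, add_zero] at h0
    have := sq_nonneg ‖G x‖
    have h3 : ‖G x‖ ^ 2 = 0 := le_antisymm h0 this
    rwa [sq_eq_zero_iff, norm_eq_zero] at h3
  have h2 := congrArg (fun K : Submodule ℂ H => (K : Set H)) h
  rw [DenseRange, dense_iff_closure_eq]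
  exact h2

/-- `B = (G - ε)⁻¹`, the approximation of the unbounded inverse of `G`. -/
structure IsYosida (G : H →L[ℂ] H) (ε : ℝ) (B : H →L[ℂ] H) : Prop where
  right : ∀ x, G (B x) = x + (ε : ℂ) • B x
  left : ∀ x, B (G x) = x + (ε : ℂ) • B x

theorem re_inner_smul_id_sub_ge {G : H →L[ℂ] H} (hG : ∀ x, (inner ℂ (G x) x).re ≤ 0) (ε : ℝ)
    (x : H) : ε * ‖x‖ ^ 2 ≤ (inner ℂ (((ε : ℂ) • ContinuousLinearMap.id ℂ H - G) x) x).re := by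
  have := hG x
  have e : (inner ℂ (((ε : ℂ) • ContinuousLinearMap.id ℂ H - G) x) x).re =
      ε * ‖x‖ ^ 2 - (inner ℂ (G x) x).re := by
    simp only [sub_apply, smul_apply,
      ContinuousLinearMap.id_apply, inner_sub_left, inner_smul_left, Complex.conj_ofReal,
      Complex.sub_re, inner_self_eq_norm_sq_to_K, Complex.re_ofReal_mul]
    norm_cast
  rw [e]
  linarith

/-- `ε - G` is coercive with constant `ε`, hence invertible; `B` is minus its inverse. -/
theorem exists_isYosida [CompleteSpace H] {G : H →L[ℂ] H}
    (hG : ∀ x, (inner ℂ (G x) x).re ≤ 0) {ε : ℝ} (hε : 0 < ε) : ∃ B, IsYosida G ε B := by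
  obtain ⟨R, h1, h2⟩ := exists_inverse_of_coercive (T := (ε : ℂ) • ContinuousLinearMap.id ℂ H - G)
    hε (re_inner_smul_id_sub_ge hG ε)
  simp only [sub_apply, smul_apply,
    ContinuousLinearMap.id_apply, map_sub, map_smul] at h1 h2
  refine ⟨-R, fun x => ?_, fun x => ?_⟩
  · simp only [neg_apply, map_neg, smul_neg]
    nth_rewrite 2 [← h1 x]
    abel
  · simp only [neg_apply, smul_neg]
    nth_rewrite 2 [← h2 x]
    abel

namespace IsYosida

variable {G B C : H →L[ℂ] H} {ε δ : ℝ}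

theorem commute (hB : IsYosida G ε B) (hC : IsYosida G δ C) : Commute B C := by
  ext x
  change B (C x) = C (B x)
  -- `B` commutes with `G`, so `(G - δ) B C x = B x`; applying `C` undoes `G - δ`.
  have h1 : G (B (C x)) = B x + (δ : ℂ) • B (C x) := by
    rw [hB.right, ← hB.left, hC.right, map_add, map_smul]
  have h2 := hC.left (B (C x))
  rw [h1, map_add, map_smul, add_left_inj] at h2
  exact h2.symm

/-- Substituting `x = (G - ε) B x` turns `Re ⟨B x, x⟩` into `Re ⟨G B x, B x⟩ - ε ‖B x‖²`. -/
theorem dissipative (hB : IsYosida G ε B) (hG : ∀ x, (inner ℂ (G x) x).re ≤ 0) (hε : 0 < ε)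
    (x : H) : (inner ℂ (B x) x).re ≤ 0 := by
  have hx : x = G (B x) - (ε : ℂ) • B x := by rw [hB.right, add_sub_cancel_right]
  have h := hG (B x)
  have e : inner ℂ (B x) x =
      inner ℂ (B x) (G (B x)) - (ε : ℂ) * inner ℂ (B x) (B x) := by
    conv_lhs => rw [hx]
    rw [inner_sub_right, inner_smul_right, ← hx]
  rw [e, Complex.sub_re, Complex.re_ofReal_mul]
  have h2 : (inner ℂ (B x) (G (B x))).re = (inner ℂ (G (B x)) (B x)).re :=
    inner_re_symm (𝕜 := ℂ) _ _
  have h3 : 0 ≤ (inner ℂ (B x) (B x)).re := inner_self_nonneg (𝕜 := ℂ)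
  rw [h2]
  nlinarith

theorem norm_smul_le (hB : IsYosida G ε B) (hG : ∀ x, (inner ℂ (G x) x).re ≤ 0)
    (x : H) : ε * ‖B x‖ ≤ ‖x‖ := by
  have h := norm_le_of_coercive (T := (ε : ℂ) • ContinuousLinearMap.id ℂ H - G) (ε := ε)
    (re_inner_smul_id_sub_ge hG ε) (B x)
  simp only [sub_apply, smul_apply,
    ContinuousLinearMap.id_apply] at h
  rw [hB.right, sub_add_cancel_right, norm_neg] at h
  exact h

/-- `B G = 1 + ε B` and `ε B` is a contraction, so the bound on `B G` does not depend on `ε`. -/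
theorem norm_apply_map_le (hB : IsYosida G ε B) (hG : ∀ x, (inner ℂ (G x) x).re ≤ 0)
    (hε : 0 < ε) (x : H) : ‖B (G x)‖ ≤ 2 * ‖x‖ := by
  rw [hB.left]
  have h1 := norm_add_le x ((ε : ℂ) • B x)
  have h2 := hB.norm_smul_le hG x
  rw [norm_smul, Complex.norm_real, Real.norm_of_nonneg hε.le] at h1
  linarith

/-- Strong continuity at `t = 0`, uniformly in `ε`: `z` is free and will be chosen with `G z` close
to `w`. On `w - G z` only contractivity is used; on `G z` the comparison is with the group generated
by `0`. -/
theorem norm_exp_sub_le [CompleteSpace H] (hB : IsYosida G ε B)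
    (hG : ∀ x, (inner ℂ (G x) x).re ≤ 0) (hε : 0 < ε) {t : ℝ} (ht : 0 ≤ t) (w z : H) :
    ‖NormedSpace.exp (t • B) w - w‖ ≤ 2 * ‖w - G z‖ + t * (2 * ‖z‖) := by
  have hd := hB.dissipative hG hε
  have h1 := norm_exp_smul_apply_le hd ht (w - G z)
  have h2 := norm_exp_smul_sub_exp_smul_le (Commute.zero_right B) hd (by simp) ht (G z)
  simp only [smul_zero, NormedSpace.exp_zero, one_apply_eq_self, zero_apply,
    sub_zero] at h2
  have h3 := mul_le_mul_of_nonneg_left (hB.norm_apply_map_le hG hε z) ht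
  have e : NormedSpace.exp (t • B) w - w = NormedSpace.exp (t • B) (w - G z) +
      (NormedSpace.exp (t • B) (G z) - G z) - (w - G z) := by
    rw [map_sub]
    abel
  rw [e]
  have h4 := norm_sub_le (NormedSpace.exp (t • B) (w - G z) +
      (NormedSpace.exp (t • B) (G z) - G z)) (w - G z)
  have h5 := norm_add_le (NormedSpace.exp (t • B) (w - G z))
      (NormedSpace.exp (t • B) (G z) - G z)
  linarith

/-- The derivative of `exp (s B) (G w) - s w` is `exp (s B) (B G w) - w`, which is small because `B
G w` is close to `w` and `exp (s B)` is close to the identity at `w`. This becomes the difference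
quotient of the limit semigroup at `G w`. -/
theorem norm_exp_sub_sub_le [CompleteSpace H] (hB : IsYosida G ε B)
    (hG : ∀ x, (inner ℂ (G x) x).re ≤ 0) (hε : 0 < ε) {t : ℝ} (ht : 0 ≤ t) (w z : H) :
    ‖NormedSpace.exp (t • B) (G w) - G w - t • w‖ ≤
      t * (‖B (G w) - w‖ + (2 * ‖w - G z‖ + t * (2 * ‖z‖))) := by
  have hd := hB.dissipative hG hε
  have hder : ∀ s : ℝ, HasDerivAt (fun s : ℝ => NormedSpace.exp (s • B) (G w) - s • w)
      (NormedSpace.exp (s • B) (B (G w)) - (1 : ℝ) • w) s := fun s =>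
    (hasDerivAt_exp_smul_apply B (G w) s).sub ((hasDerivAt_id s).smul_const w)
  have h := norm_image_sub_le_of_norm_deriv_le_segment' (a := 0) (b := t)
    (C := ‖B (G w) - w‖ + (2 * ‖w - G z‖ + t * (2 * ‖z‖)))
    (fun s _ => (hder s).hasDerivWithinAt) (fun s hs => by
      have e : NormedSpace.exp (s • B) (B (G w)) - (1 : ℝ) • w =
          NormedSpace.exp (s • B) (B (G w) - w) + (NormedSpace.exp (s • B) w - w) := by
        rw [map_sub, one_smul]
        abel
      rw [e]
      have h1 := norm_add_le (NormedSpace.exp (s • B) (B (G w) - w))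
        (NormedSpace.exp (s • B) w - w)
      have h2 := norm_exp_smul_apply_le hd hs.1 (B (G w) - w)
      have h3 := hB.norm_exp_sub_le hG hε hs.1 w z
      have h4 : s * (2 * ‖z‖) ≤ t * (2 * ‖z‖) :=
        mul_le_mul_of_nonneg_right hs.2.le (by positivity)
      linarith) t ⟨ht, le_rfl⟩
  simp only [zero_smul, NormedSpace.exp_zero, one_apply_eq_self, sub_zero] at h
  rw [mul_comm, sub_right_comm]
  exact h

end IsYosida

end Hilbert

/-! ### Generation of the semigroup from the Yosida approximations -/

section Generation

variable {H : Type*} [NormedAddCommGroup H] [InnerProductSpace ℂ H]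

/-- The error is `ε B w`. For `w = G z` it is at most `2 ε ‖z‖`; the general case follows by
density, since `ε B` is a contraction. -/
theorem tendsto_yosida_apply {G : H →L[ℂ] H} (hG : ∀ x, (inner ℂ (G x) x).re ≤ 0)
    (hdense : DenseRange G) {ε : ℕ → ℝ} (hε : ∀ n, 0 < ε n) (hε0 : Tendsto ε atTop (𝓝 0))
    {B : ℕ → H →L[ℂ] H} (hB : ∀ n, IsYosida G (ε n) (B n)) (w : H) :
    Tendsto (fun n => B n (G w)) atTop (𝓝 w) := by
  rw [tendsto_iff_norm_sub_tendsto_zero, Metric.tendsto_atTop]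
  intro η hη
  obtain ⟨z, hz⟩ := Metric.denseRange_iff.1 hdense w (η / 2) (by positivity)
  rw [dist_eq_norm] at hz
  have h1 : ∀ᶠ n in atTop, ε n * (2 * ‖z‖) < η / 2 := by
    have : Tendsto (fun n => ε n * (2 * ‖z‖)) atTop (𝓝 (0 * (2 * ‖z‖))) := hε0.mul_const _
    rw [zero_mul] at this
    exact this.eventually_lt_const (by positivity)
  obtain ⟨N, hN⟩ := eventually_atTop.1 h1
  refine ⟨N, fun n hn => ?_⟩
  rw [dist_zero_right, norm_norm, (hB n).left, add_sub_cancel_left, norm_smul, Complex.norm_real,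
    Real.norm_of_nonneg (hε n).le]
  have e : B n w = B n (w - G z) + B n (G z) := by rw [map_sub, sub_add_cancel]
  have h2 := (hB n).norm_smul_le hG (w - G z)
  have h3 := mul_le_mul_of_nonneg_left ((hB n).norm_apply_map_le hG (hε n) z) (hε n).le
  have h4 := mul_le_mul_of_nonneg_left (norm_add_le (B n (w - G z)) (B n (G z))) (hε n).le
  rw [e]
  linarith [hN n hn]

/-- Generation theorem: a dissipative operator on a Hilbert space with a bounded everywhere
defined inverse generates a `C₀`-semigroup (of contractions). -/
theorem exists_semigroup_of_dissipative [CompleteSpace H] (A : H →ₗ.[ℂ] H) (G : H →L[ℂ] H)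
    (hA : ∀ x y, (x, y) ∈ A.graph ↔ x = G y) (hG : ∀ x, (inner ℂ (G x) x).re ≤ 0) :
    ∃ S : C0Semigroup H, S.HasGenerator A := by
  have hinj : ∀ y, G y = 0 → y = 0 := fun y hy =>
    A.graph_fst_eq_zero_snd ((hA 0 y).2 hy.symm) rfl
  have hdense := dense_range_of_dissipative hG hinj
  obtain ⟨ε, -, hε, hε0⟩ := exists_seq_strictAnti_tendsto (0 : ℝ)
  choose B hB using fun n => exists_isYosida hG (hε n)
  have hBd := fun n => (hB n).dissipative hG (hε n)
  have hBG := tendsto_yosida_apply hG hdense hε hε0 hB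
  -- On the range of `G` the exponentials differ by at most `t ‖B_m G w - B_n G w‖`; contractivity
  -- carries the Cauchy property to the closure of the range, which is everything.
  have hcauchy : ∀ (t : ℝ≥0) (x : H),
      CauchySeq fun n => NormedSpace.exp ((t : ℝ) • B n) x := by
    intro t x
    rw [Metric.cauchySeq_iff]
    intro η hη
    obtain ⟨w, hw⟩ := Metric.denseRange_iff.1 hdense x (η / 3) (by positivity)
    rw [dist_eq_norm] at hw
    have h1 := (hBG w).cauchySeq
    rw [Metric.cauchySeq_iff] at h1
    -- The denominator is `t + 1` so that `t = 0` needs no separate treatment.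
    obtain ⟨N, hN⟩ := h1 (η / 3 / (t + 1)) (by positivity)
    refine ⟨N, fun m hm n hn => ?_⟩
    have h2 := norm_exp_smul_apply_le (hBd m) t.2 (x - G w)
    have h3 := norm_exp_smul_apply_le (hBd n) t.2 (x - G w)
    have h4 := norm_exp_smul_sub_exp_smul_le ((hB m).commute (hB n)) (hBd m) (hBd n) t.2 (G w)
    have h5 := hN m hm n hn
    rw [dist_eq_norm, lt_div_iff₀ (by positivity)] at h5
    have h6 := norm_nonneg (B m (G w) - B n (G w))
    rw [dist_eq_norm]
    have e : NormedSpace.exp ((t : ℝ) • B m) x - NormedSpace.exp ((t : ℝ) • B n) x =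
        NormedSpace.exp ((t : ℝ) • B m) (x - G w) - NormedSpace.exp ((t : ℝ) • B n) (x - G w) +
        (NormedSpace.exp ((t : ℝ) • B m) (G w) - NormedSpace.exp ((t : ℝ) • B n) (G w)) := by
      rw [map_sub, map_sub]
      abel
    rw [e]
    refine (norm_add_le _ _).trans_lt ?_
    have h7 := norm_sub_le (NormedSpace.exp ((t : ℝ) • B m) (x - G w))
      (NormedSpace.exp ((t : ℝ) • B n) (x - G w))
    change _ ≤ (t : ℝ) * _ at h4
    change ‖NormedSpace.exp ((t : ℝ) • B m) (x - G w)‖ ≤ _ at h2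
    change ‖NormedSpace.exp ((t : ℝ) • B n) (x - G w)‖ ≤ _ at h3
    change ‖NormedSpace.exp ((t : ℝ) • B m) (G w) - NormedSpace.exp ((t : ℝ) • B n) (G w)‖ ≤ _
      at h4
    linarith
  choose L hL using fun t x => cauchySeq_tendsto_of_complete (hcauchy t x)
  let T : ℝ≥0 → H →L[ℂ] H := fun t => LinearMap.mkContinuous
    { toFun := L t
      map_add' := fun x y => tendsto_nhds_unique (hL t (x + y)) (by
        simpa only [map_add] using (hL t x).add (hL t y))
      map_smul' := fun r x => tendsto_nhds_unique (hL t (r • x)) (by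
        simpa only [map_smul, RingHom.id_apply] using (hL t x).const_smul r) } 1 (fun x => by
      rw [one_mul]
      exact le_of_tendsto (hL t x).norm (Eventually.of_forall fun n =>
        norm_exp_smul_apply_le (hBd n) t.2 x))
  have hT : ∀ (t : ℝ≥0) (x : H),
      Tendsto (fun n => NormedSpace.exp ((t : ℝ) • B n) x) atTop (𝓝 (T t x)) := hL
  have hTle : ∀ (t : ℝ≥0) (x : H), ‖T t x‖ ≤ ‖x‖ := fun t x =>
    le_of_tendsto (hT t x).norm (Eventually.of_forall fun n =>
        norm_exp_smul_apply_le (hBd n) t.2 x)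
  have hTsub : ∀ (t : ℝ≥0) (w z : H), ‖T t w - w‖ ≤ 2 * ‖w - G z‖ + t * (2 * ‖z‖) :=
    fun t w z => le_of_tendsto ((hT t w).sub_const w).norm (Eventually.of_forall fun n =>
        (hB n).norm_exp_sub_le hG (hε n) t.2 w z)
  have hTgen : ∀ (t : ℝ≥0) (w z : H), ‖T t (G w) - G w - (t : ℝ) • w‖ ≤
      t * (2 * ‖w - G z‖ + t * (2 * ‖z‖)) := by
    intro t w z
    have h1 := (((hT t (G w)).sub_const (G w)).sub_const ((t : ℝ) • w)).norm
    have h2 : Tendsto (fun n => (t : ℝ) * (‖B n (G w) - w‖ + (2 * ‖w - G z‖ + t * (2 * ‖z‖))))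
        atTop (𝓝 ((t : ℝ) * (0 + (2 * ‖w - G z‖ + t * (2 * ‖z‖))))) :=
      ((tendsto_iff_norm_sub_tendsto_zero.1 (hBG w)).add_const _).const_mul _
    rw [zero_add] at h2
    exact le_of_tendsto_of_tendsto' h1 h2 fun n =>
      (hB n).norm_exp_sub_sub_le hG (hε n) t.2 w z
  have hsmall : ∀ w : H, ∀ η > 0, ∃ z, ∀ᶠ t : ℝ≥0 in 𝓝 0,
      2 * ‖w - G z‖ + t * (2 * ‖z‖) < η := by
    intro w η hη
    obtain ⟨z, hz⟩ := Metric.denseRange_iff.1 hdense w (η / 2) (by positivity)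
    rw [dist_eq_norm] at hz
    refine ⟨z, ?_⟩
    have h1 : Tendsto (fun t : ℝ≥0 => 2 * ‖w - G z‖ + (t : ℝ) * (2 * ‖z‖)) (𝓝 0)
        (𝓝 (2 * ‖w - G z‖ + ((0 : ℝ≥0) : ℝ) * (2 * ‖z‖))) :=
      Continuous.tendsto (by fun_prop) 0
    apply h1.eventually_lt_const
    rw [NNReal.coe_zero, zero_mul]
    linarith
  let S : C0Semigroup H :=
    { T := T
      map_zero := by
        ext x
        refine tendsto_nhds_unique (hT 0 x) ?_
        simp
      map_add := by
        intro s t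
        ext x
        refine tendsto_nhds_unique (hT (s + t) x) ?_
        have h1 : ∀ n, NormedSpace.exp (((s + t : ℝ≥0) : ℝ) • B n) x =
            NormedSpace.exp ((s : ℝ) • B n) (NormedSpace.exp ((t : ℝ) • B n) x) := by
          intro n
          let _ : NormedAlgebra ℚ (H →L[ℂ] H) := NormedAlgebra.restrictScalars ℚ ℂ _
          rw [NNReal.coe_add, add_smul, NormedSpace.exp_add_of_commute]
          · rfl
          · exact ((Commute.refl (B n)).smul_left _).smul_right _
        simp_rw [h1]
        change Tendsto _ _ (𝓝 (T s (T t x)))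
        rw [tendsto_iff_norm_sub_tendsto_zero]
        have h2 := (tendsto_iff_norm_sub_tendsto_zero.1 (hT t x)).add
          (tendsto_iff_norm_sub_tendsto_zero.1 (hT s (T t x)))
        rw [add_zero] at h2
        refine squeeze_zero (fun n => norm_nonneg _) (fun n => ?_) h2
        have h3 := norm_exp_smul_apply_le (hBd n) s.2 (NormedSpace.exp ((t : ℝ) • B n) x - T t x)
        refine le_trans ?_ (add_le_add_left h3 _)
        refine le_trans (le_of_eq ?_) (norm_add_le _ _)
        congr 1
        rw [map_sub]
        change _ = NormedSpace.exp ((s : ℝ) • B n) _ - NormedSpace.exp ((s : ℝ) • B n) _ + _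
        abel
      tendsto_zero := by
        intro x
        rw [Metric.tendsto_nhds]
        intro η hη
        obtain ⟨z, hz⟩ := hsmall x η hη
        filter_upwards [hz] with t ht
        rw [dist_eq_norm]
        exact (hTsub t x z).trans_lt ht }
  have hgen : ∀ w, Tendsto (fun t : ℝ≥0 => (t : ℝ)⁻¹ • (T t (G w) - G w)) (𝓝[>] 0) (𝓝 w) := by
    intro w
    rw [Metric.tendsto_nhds]
    intro η hη
    obtain ⟨z, hz⟩ := hsmall w η hη
    filter_upwards [nhdsWithin_le_nhds hz, self_mem_nhdsWithin] with t ht ht0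
    have ht0' : (0 : ℝ) < t := ht0
    have e : (t : ℝ)⁻¹ • (T t (G w) - G w) - w =
        (t : ℝ)⁻¹ • (T t (G w) - G w - (t : ℝ) • w) := by
      rw [smul_sub _ _ ((t : ℝ) • w), inv_smul_smul₀ ht0'.ne']
    rw [dist_eq_norm, e, norm_smul, norm_inv, Real.norm_of_nonneg ht0'.le, inv_mul_lt_iff₀ ht0']
    exact (hTgen t w z).trans_lt (mul_lt_mul_of_pos_left ht ht0')
  refine ⟨S, fun x y => ⟨fun h => ?_, fun h => ?_⟩⟩
  · rw [(hA x y).1 h]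
    exact hgen y
  · -- `x - G w` is an eigenvector of a dissipative operator for the eigenvalue `1`
    obtain ⟨w, hw⟩ : ∃ w, G w - w = x - y := by
      obtain ⟨C, hC⟩ := exists_isYosida hG one_pos
      refine ⟨C (x - y), ?_⟩
      rw [hC.right, Complex.ofReal_one, one_smul, add_sub_cancel_right]
    have h1 : Tendsto (fun t : ℝ≥0 => (t : ℝ)⁻¹ • (T t (x - G w) - (x - G w))) (𝓝[>] 0)
        (𝓝 (x - G w)) := by
      have h2 := Tendsto.sub h (hgen w)
      have e : y - w = x - G w := by
        rw [sub_eq_sub_iff_add_eq_add] at hw ⊢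
        rw [add_comm, hw, add_comm]
      rw [e] at h2
      refine h2.congr fun t => ?_
      change (t : ℝ)⁻¹ • (T t x - x) - (t : ℝ)⁻¹ • (T t (G w) - G w) = _
      rw [← smul_sub, map_sub]
      congr 1
      abel
    set u := x - G w with hu
    have h3 : Tendsto (fun t : ℝ≥0 => (inner ℂ ((t : ℝ)⁻¹ • (T t u - u)) u).re) (𝓝[>] 0)
        (𝓝 (inner ℂ u u).re) :=
      (Complex.continuous_re.tendsto _).comp (h1.inner tendsto_const_nhds)
    -- `‖u‖²` is the limit of `Re ⟨(T t u - u) / t, u⟩`, and these numbers are nonpositive because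
    -- `T t` is a contraction.
    have h4 : (inner ℂ u u).re ≤ 0 := by
      refine le_of_tendsto h3 (Eventually.of_forall fun t => ?_)
      have e : inner ℂ ((t : ℝ)⁻¹ • (T t u - u)) u =
          (((t : ℝ)⁻¹ : ℝ) : ℂ) * (inner ℂ (T t u) u - inner ℂ u u) := by
        rw [← Complex.coe_smul, inner_smul_left, Complex.conj_ofReal, inner_sub_left]
      rw [e, Complex.re_ofReal_mul, Complex.sub_re]
      have h5 : (inner ℂ (T t u) u).re ≤ ‖T t u‖ * ‖u‖ := re_inner_le_norm (𝕜 := ℂ) _ _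
      have h6 : (inner ℂ u u).re = ‖u‖ * ‖u‖ :=
        inner_self_eq_norm_mul_norm (𝕜 := ℂ) u
      have h7 := mul_le_mul_of_nonneg_right (hTle t u) (norm_nonneg u)
      apply mul_nonpos_of_nonneg_of_nonpos (inv_nonneg.2 t.2)
      linarith
    have h5 : u = 0 := by
      have h6 : (inner ℂ u u).re = ‖u‖ ^ 2 := by
        rw [inner_self_eq_norm_sq_to_K]
        norm_cast
      rw [h6] at h4
      have := le_antisymm h4 (sq_nonneg ‖u‖)
      rwa [sq_eq_zero_iff, norm_eq_zero] at this
    rw [hA]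
    have h6 : x = G w := sub_eq_zero.1 h5
    rw [h6] at hw
    rw [h6, sub_right_injective hw]

end Generation

/-! ### Resolvent bound on the imaginary axis from exponential decay -/

section Stability

variable {X : Type*} [NormedAddCommGroup X] [NormedSpace ℂ X]

theorem C0Semigroup.continuous_apply {S : C0Semigroup X} {M : ℝ} (hM : ∀ t, ‖S.T t‖ ≤ M) (x : X) :
    Continuous fun t => S.T t x := by
  rw [continuous_iff_continuousAt]
  intro t
  have hM0 : 0 ≤ M := (norm_nonneg _).trans (hM 0)
  have h1 : Tendsto (fun s : ℝ≥0 => nndist s t) (𝓝 t) (𝓝 0) := by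
    have : Tendsto (fun s : ℝ≥0 => nndist s t) (𝓝 t) (𝓝 (nndist t t)) :=
      Continuous.tendsto (by fun_prop) t
    rwa [nndist_self] at this
  have h2 := (tendsto_iff_norm_sub_tendsto_zero.1 ((S.tendsto_zero x).comp h1)).const_mul M
  rw [mul_zero] at h2
  have key : ∀ s r : ℝ≥0, ‖S.T (s + r) x - S.T s x‖ ≤ M * ‖S.T r x - x‖ := by
    intro s r
    rw [S.map_add, ContinuousLinearMap.comp_apply, ← map_sub]
    exact ((S.T s).le_opNorm _).trans (mul_le_mul_of_nonneg_right (hM s) (norm_nonneg _))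
  refine tendsto_iff_norm_sub_tendsto_zero.2 (squeeze_zero (fun _ => norm_nonneg _) (fun s => ?_) h2)
  rcases le_total s t with h | h
  · have e : t = s + nndist s t := by
      apply NNReal.coe_injective
      rw [NNReal.coe_add, coe_nndist, NNReal.dist_eq, abs_of_nonpos (sub_nonpos.2 (NNReal.coe_le_coe.2 h))]
      ring
    rw [norm_sub_rev]
    conv_lhs => rw [e]
    exact key s _
  · have e : s = t + nndist s t := by
      apply NNReal.coe_injective
      rw [NNReal.coe_add, coe_nndist, NNReal.dist_eq, abs_of_nonneg (sub_nonneg.2 (NNReal.coe_le_coe.2 h))]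
      ring
    conv_lhs => rw [e]
    exact key t _

/-- The semigroup law transports the difference quotient at `0` to `t`. A right derivative is enough
for the mean value inequality used below. -/
theorem C0Semigroup.HasGenerator.hasDerivWithinAt {S : C0Semigroup X} {A : X →ₗ.[ℂ] X}
    (h : S.HasGenerator A) {x y : X} (hxy : (x, y) ∈ A.graph) {t : ℝ} (ht : 0 ≤ t) :
    HasDerivWithinAt (fun s : ℝ => S.T s.toNNReal x) (S.T t.toNNReal y) (Ici t) t := by
  rw [← hasDerivWithinAt_Ioi_iff_Ici, hasDerivWithinAt_iff_tendsto_slope' self_notMem_Ioi]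
  have h1 : Tendsto (fun s : ℝ => (s - t).toNNReal) (𝓝[>] t) (𝓝[>] 0) := by
    apply tendsto_nhdsWithin_of_tendsto_nhds_of_eventually_within
    · have : Tendsto (fun s : ℝ => (s - t).toNNReal) (𝓝 t) (𝓝 (t - t).toNNReal) :=
        Continuous.tendsto (by fun_prop) t
      rw [sub_self, Real.toNNReal_zero] at this
      exact this.mono_left nhdsWithin_le_nhds
    · filter_upwards [self_mem_nhdsWithin] with s hs
      exact Real.toNNReal_pos.2 (sub_pos.2 hs)
  have h2 := ((S.T t.toNNReal).continuous.tendsto y).comp (((h x y).1 hxy).comp h1)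
  refine h2.congr' ?_
  filter_upwards [self_mem_nhdsWithin] with s hs
  have hs' : t < s := hs
  have e : s.toNNReal = t.toNNReal + (s - t).toNNReal := by
    rw [← Real.toNNReal_add ht (sub_nonneg.2 hs'.le), add_sub_cancel]
  change S.T t.toNNReal ((((s - t).toNNReal : ℝ≥0) : ℝ)⁻¹ • (S.T (s - t).toNNReal x - x)) = _
  rw [slope_def_module, e, S.map_add, Real.coe_toNNReal _ (sub_nonneg.2 hs'.le),
    ContinuousLinearMap.comp_apply, ← map_sub, ContinuousLinearMap.map_smul_of_tower]

/-- The generator of an exponentially stable semigroup is bounded below along the imaginary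
axis. -/
theorem C0Semigroup.ExpStable.exists_norm_le {S : C0Semigroup X} (hS : S.ExpStable) :
    ∃ K : ℝ, 0 ≤ K ∧ ∀ A : X →ₗ.[ℂ] X, S.HasGenerator A → ∀ x y : X, (x, y) ∈ A.graph →
      ∀ l : ℝ, ‖x‖ ≤ K * ‖y - (Complex.I * l) • x‖ := by
  obtain ⟨M, hM, α, hα, hS⟩ := hS
  refine ⟨M / α, by positivity, fun A hA x y hxy l => ?_⟩
  set z := y - (Complex.I * l) • x with hz
  have hSM : ∀ t, ‖S.T t‖ ≤ M := fun t => (hS t).trans (by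
    have : Real.exp (-α * t) ≤ 1 := Real.exp_le_one_iff.2 (by
      have := t.2
      have : (0 : ℝ) ≤ t := this
      nlinarith)
    nlinarith)
  let w : ℝ → ℂ := fun t => Complex.exp (t * -(Complex.I * l))
  have hwn : ∀ t, ‖w t‖ = 1 := fun t => by
    have : (t : ℂ) * -(Complex.I * l) = ((-(t * l) : ℝ) : ℂ) * Complex.I := by
      push_cast
      ring
    simp only [w]
    rw [this, Complex.norm_exp_ofReal_mul_I]
  have hw : ∀ t, HasDerivAt w (w t * -(Complex.I * l)) t := fun t => by
    have h1 := (Complex.ofRealCLM.hasDerivAt (x := t)).mul_const (-(Complex.I * l))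
    simpa only [Complex.ofRealCLM_apply, Complex.ofReal_one, one_mul] using h1.cexp
  -- The orbit of `x`, multiplied by `e^{-ilt}`, has the decaying derivative `e^{-ilt} S(t) z`. It
  -- therefore moves by at most `(M / α) ‖z‖`, while it tends to `0`.
  have hder : ∀ t : ℝ, 0 ≤ t → HasDerivWithinAt (fun s => w s • S.T s.toNNReal x - x)
      (w t • S.T t.toNNReal z) (Ici t) t := by
    intro t ht
    have h1 := ((hw t).hasDerivWithinAt (s := Ici t)).smul (hA.hasDerivWithinAt hxy ht)
    have h2 := h1.sub_const x
    have e : w t • S.T t.toNNReal z = w t • (S.T t.toNNReal) y +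
        (w t * -(Complex.I * l)) • (S.T t.toNNReal) x := by
      rw [hz, map_sub, map_smul]
      module
    rw [e]
    exact h2
  have hcont : Continuous (fun s : ℝ => w s • S.T s.toNNReal x - x) := by
    have h1 : Continuous w := continuous_iff_continuousAt.2 fun t => (hw t).continuousAt
    have h2 := (S.continuous_apply hSM x).comp continuous_real_toNNReal
    exact (h1.smul h2).sub continuous_const
  have hnorm : ∀ t : ℝ, 0 ≤ t → ∀ v : X,
      ‖w t • S.T t.toNNReal v‖ ≤ M * Real.exp (-α * t) * ‖v‖ := by
    intro t ht v
    rw [norm_smul, hwn, one_mul]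
    refine ((S.T _).le_opNorm v).trans (mul_le_mul_of_nonneg_right ?_ (norm_nonneg v))
    simpa only [Real.coe_toNNReal _ ht] using hS t.toNNReal
  have hbound : ∀ t : ℝ, 0 ≤ t → ‖w t • S.T t.toNNReal x - x‖ ≤ M / α * ‖z‖ := by
    intro t ht
    -- The comparison function is the integral of `M e^{-αr} ‖z‖` over `[0, s]`.
    have hBd : ∀ s : ℝ, HasDerivAt (fun s : ℝ => M / α * ‖z‖ * (1 - Real.exp (-α * s)))
        (M * Real.exp (-α * s) * ‖z‖) s := by
      intro s
      have h1 := (((hasDerivAt_id s).const_mul (-α)).exp.const_sub 1).const_mul (M / α * ‖z‖)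
      refine h1.congr_deriv ?_
      simp only [id]
      field_simp
    have h := image_norm_le_of_norm_deriv_right_le_deriv_boundary (a := 0) (b := t)
      (f := fun s => w s • S.T s.toNNReal x - x) (f' := fun s => w s • S.T s.toNNReal z)
      hcont.continuousOn (fun s hs => hder s hs.1)
      (B := fun s : ℝ => M / α * ‖z‖ * (1 - Real.exp (-α * s)))
      (B' := fun s => M * Real.exp (-α * s) * ‖z‖) (by
        simp [w, S.map_zero]) hBd (fun s hs => hnorm s hs.1 z) ⟨ht, le_rfl⟩
    refine h.trans ?_
    have := Real.exp_pos (-α * t)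
    have h0 : 0 ≤ M / α * ‖z‖ := by positivity
    nlinarith
  have hlim : Tendsto (fun t : ℝ => M / α * ‖z‖ + M * Real.exp (-α * t) * ‖x‖) atTop
      (𝓝 (M / α * ‖z‖ + M * 0 * ‖x‖)) := by
    have h1 : Tendsto (fun t : ℝ => Real.exp (-α * t)) atTop (𝓝 0) :=
      Real.tendsto_exp_atBot.comp (tendsto_id.const_mul_atTop_of_neg (neg_lt_zero.2 hα))
    exact ((h1.const_mul M).mul_const _).const_add _
  rw [mul_zero, zero_mul, add_zero] at hlim
  refine ge_of_tendsto hlim ?_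
  filter_upwards [eventually_ge_atTop 0] with t ht
  have h1 := hbound t ht
  have h2 := hnorm t ht x
  have h3 := norm_sub_norm_le x (w t • S.T t.toNNReal x)
  rw [norm_sub_rev] at h3
  linarith

end Stability

/-! ### Weak derivatives of functions glued at the discontinuity of the damping -/

section Piecewise

/-- The function which is `f` on the negative half line and `g` on the positive one. -/
def glue (f g : ℝ → ℂ) (x : ℝ) : ℂ := if 0 ≤ x then g x else f x

theorem glue_self (f : ℝ → ℂ) : glue f f = f := by
  funext x
  simp [glue]

theorem glue_of_nonneg {f g : ℝ → ℂ} {x : ℝ} (h : 0 ≤ x) : glue f g x = g x := if_pos h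

theorem glue_of_neg {f g : ℝ → ℂ} {x : ℝ} (h : x < 0) : glue f g x = f x := if_neg (not_le.2 h)

theorem continuous_glue {f g : ℝ → ℂ} (hf : Continuous f) (hg : Continuous g) (h : f 0 = g 0) :
    Continuous (glue f g) :=
  hg.if_le hf continuous_const continuous_id fun x hx => by rw [← hx, h]

theorem measurable_glue {f g : ℝ → ℂ} (hf : Continuous f) (hg : Continuous g) :
    Measurable (glue f g) :=
  Measurable.ite measurableSet_Ici hg.measurable hf.measurable

theorem ae_mu_of_forall_mem {P : ℝ → Prop} (h : ∀ x ∈ Ioo (-1 : ℝ) 1, P x) : ∀ᵐ x ∂mu, P x :=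
  (ae_restrict_iff' measurableSet_Ioo).2 (Eventually.of_forall h)

theorem memLp_glue {f g : ℝ → ℂ} (hf : Continuous f) (hg : Continuous g) :
    MemLp (glue f g) 2 mu := by
  obtain ⟨C, hC⟩ := isCompact_Icc.exists_bound_of_continuousOn (s := Icc (-1 : ℝ) 1) hf.continuousOn
  obtain ⟨D, hD⟩ := isCompact_Icc.exists_bound_of_continuousOn (s := Icc (-1 : ℝ) 1) hg.continuousOn
  refine MemLp.of_bound (measurable_glue hf hg).aestronglyMeasurable (max C D)
    (ae_mu_of_forall_mem fun x hx => ?_)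
  rcases le_or_gt 0 x with h | h
  · rw [glue_of_nonneg h]
    exact (hD x (Ioo_subset_Icc_self hx)).trans (le_max_right _ _)
  · rw [glue_of_neg h]
    exact (hC x (Ioo_subset_Icc_self hx)).trans (le_max_left _ _)

theorem memLp_of_continuous {f : ℝ → ℂ} (hf : Continuous f) : MemLp f 2 mu := by
  have := memLp_glue hf hf
  rwa [glue_self] at this

theorem integral_mu_eq (f : ℝ → ℂ) : ∫ x, f x ∂mu = ∫ x in (-1 : ℝ)..1, f x := by
  rw [intervalIntegral.integral_of_le (by norm_num), ← integral_Ioc_eq_integral_Ioo]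

/-- Two `C¹` functions with the same value at `0` glue to a weakly differentiable function. -/
theorem isWeakDeriv_of_glue {f₁ f₂ g₁ g₂ : ℝ → ℂ} (h₁ : ∀ x, HasDerivAt f₁ (g₁ x) x)
    (h₂ : ∀ x, HasDerivAt f₂ (g₂ x) x) (c₁ : Continuous g₁) (c₂ : Continuous g₂)
    (h0 : f₁ 0 = f₂ 0) {F G : L2} (hF : F =ᵐ[mu] glue f₁ f₂) (hG : G =ᵐ[mu] glue g₁ g₂) :
    IsWeakDeriv F G := by
  intro φ hφ
  have k₁ : Continuous f₁ := continuous_iff_continuousAt.2 fun x => (h₁ x).continuousAt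
  have k₂ : Continuous f₂ := continuous_iff_continuousAt.2 fun x => (h₂ x).continuousAt
  have hφd : ∀ x, HasDerivAt φ (deriv φ x) x := fun x =>
    (hφ.1.differentiable (by simp) x).hasDerivAt
  have e1 : ∫ x, deriv φ x • F x ∂mu = ∫ x, deriv φ x • glue f₁ f₂ x ∂mu :=
    integral_congr_ae (hF.mono fun x hx => by simp only [hx])
  have e2 : ∫ x, φ x • G x ∂mu = ∫ x, φ x • glue g₁ g₂ x ∂mu :=
    integral_congr_ae (hG.mono fun x hx => by simp only [hx])
  have i1 : Integrable (fun x => deriv φ x • glue f₁ f₂ x) mu :=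
    hφ.deriv_test.integrable_smul ((memLp_glue k₁ k₂).integrable (by norm_num))
  have i2 : Integrable (fun x => φ x • glue g₁ g₂ x) mu :=
    hφ.integrable_smul ((memLp_glue c₁ c₂).integrable (by norm_num))
  rw [e1, e2, eq_neg_iff_add_eq_zero, ← integral_add i1 i2, integral_mu_eq]
  have hz : ∀ x, x ∉ Ioo (-1 : ℝ) 1 → φ x = 0 := fun x hx =>
    image_eq_zero_of_notMem_tsupport fun hh => hx (hφ.2.2 hh)
  -- The fundamental theorem of calculus for `φ F`, which is continuous and differentiable off the
  -- point `0`; the boundary values vanish with `φ`.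
  have h := integral_eq_of_hasDerivAt_off_countable (fun x => φ x • glue f₁ f₂ x)
    (fun x => deriv φ x • glue f₁ f₂ x + φ x • glue g₁ g₂ x) (a := -1) (b := 1) (s := {0})
    (countable_singleton 0)
    (hφ.1.continuous.smul (continuous_glue k₁ k₂ h0)).continuousOn (by
      intro x hx
      have hx0 : x ≠ 0 := hx.2
      have hgl : HasDerivAt (glue f₁ f₂) (glue g₁ g₂ x) x := by
        rcases lt_or_gt_of_ne hx0 with h | h
        · rw [glue_of_neg h]
          apply (h₁ x).congr_of_eventuallyEq
          filter_upwards [Iio_mem_nhds h] with y hy using glue_of_neg hy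
        · rw [glue_of_nonneg h.le]
          apply (h₂ x).congr_of_eventuallyEq
          filter_upwards [Ioi_mem_nhds h] with y hy using glue_of_nonneg (le_of_lt hy)
      have := (hφd x).smul hgl
      rw [add_comm]
      exact this) (by
      rw [intervalIntegrable_iff_integrableOn_Ioo_of_le (by norm_num)]
      exact i1.add i2)
  rw [h, hz 1 (by simp), hz (-1) (by simp), zero_smul, zero_smul, sub_zero]

end Piecewise

/-! ### Primitives, `H¹₀` as mean zero functions, integration by parts -/

section Primitive

/-- The constant function `1`. -/
def one : L2 := (memLp_const (1 : ℂ)).toLp fun _ => 1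

theorem one_coeFn : one =ᵐ[mu] fun _ => (1 : ℂ) := MemLp.coeFn_toLp _

theorem inner_one (f : L2) : inner ℂ one f = ∫ x, f x ∂mu := by
  rw [L2.inner_def]
  refine integral_congr_ae (one_coeFn.mono fun x hx => ?_)
  simp [hx]

theorem exists_integral_norm_le : ∃ C : ℝ, 0 ≤ C ∧ ∀ f : L2, ∫ x, ‖f x‖ ∂mu ≤ C * ‖f‖ := by
  refine ⟨(mu univ ^ (1 / (1 : ENNReal).toReal - 1 / (2 : ENNReal).toReal)).toReal,
    ENNReal.toReal_nonneg, fun f => ?_⟩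
  have h := eLpNorm_le_eLpNorm_mul_rpow_measure_univ (μ := mu) (p := 1) (q := 2) (by norm_num)
    (Lp.aestronglyMeasurable f)
  have h2 := ENNReal.toReal_mono (ENNReal.mul_ne_top (Lp.eLpNorm_ne_top f)
    (ENNReal.rpow_ne_top_of_nonneg (by norm_num) (measure_ne_top mu univ))) h
  rw [ENNReal.toReal_mul, ← Lp.norm_def, eLpNorm_one_eq_lintegral_enorm, mul_comm] at h2
  rwa [integral_norm_eq_lintegral_enorm (Lp.aestronglyMeasurable f)]

/-- The primitive of `f` which vanishes at `-1`. -/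
def primFun (f : L2) (x : ℝ) : ℂ := ∫ t in (-1 : ℝ)..x, f t ∂mu

theorem L2.intervalIntegrable (f : L2) (a b : ℝ) : IntervalIntegrable f mu a b :=
  f.integrable.intervalIntegrable

theorem continuous_primFun (f : L2) : Continuous (primFun f) :=
  intervalIntegral.continuous_primitive f.intervalIntegrable (-1)

theorem primFun_neg_one (f : L2) : primFun f (-1) = 0 := intervalIntegral.integral_same

theorem primFun_one (f : L2) : primFun f 1 = ∫ x, f x ∂mu := by
  rw [primFun, intervalIntegral.integral_of_le (by norm_num), Measure.restrict_restrict
    measurableSet_Ioc, inter_eq_right.2 Ioo_subset_Ioc_self]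

theorem norm_primFun_le (f : L2) (x : ℝ) : ‖primFun f x‖ ≤ ∫ x, ‖f x‖ ∂mu :=
  intervalIntegral.norm_integral_le_integral_norm_uIoc.trans
    (setIntegral_le_integral f.integrable.norm (Eventually.of_forall fun _ => norm_nonneg _))

theorem primFun_eq_of_mem (f : L2) {x : ℝ} (hx : x ∈ Icc (-1 : ℝ) 1) :
    primFun f x = ∫ t in (-1 : ℝ)..x, f t := by
  rw [primFun, intervalIntegral.integral_of_le hx.1, intervalIntegral.integral_of_le hx.1,
    integral_Ioc_eq_integral_Ioo, integral_Ioc_eq_integral_Ioo, Measure.restrict_restrict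
    measurableSet_Ioo, inter_eq_left.2 (Ioo_subset_Ioo_right hx.2)]

/-- The operator which maps `f` to its primitive vanishing at `-1`. -/
def prim : L2 →L[ℂ] L2 := by
  refine LinearMap.mkContinuousOfExistsBound
    { toFun := fun f => (memLp_of_continuous (continuous_primFun f)).toLp
      map_add' := fun f g => ?_
      map_smul' := fun r f => ?_ } ?_
  · rw [← MemLp.toLp_add]
    apply MemLp.toLp_congr
    refine Eventually.of_forall fun x => ?_
    change primFun (f + g) x = primFun f x + primFun g x
    rw [primFun, primFun, primFun,
      ← intervalIntegral.integral_add (f.intervalIntegrable _ _) (g.intervalIntegrable _ _)]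
    apply intervalIntegral.integral_congr_ae
    filter_upwards [Lp.coeFn_add f g] with y hy _ using hy
  · rw [RingHom.id_apply, ← MemLp.toLp_const_smul]
    apply MemLp.toLp_congr
    refine Eventually.of_forall fun x => ?_
    change primFun (r • f) x = r • primFun f x
    rw [primFun, primFun, ← intervalIntegral.integral_smul]
    apply intervalIntegral.integral_congr_ae
    filter_upwards [Lp.coeFn_smul r f] with y hy _ using hy
  · obtain ⟨C, hC0, hC⟩ := exists_integral_norm_le
    refine ⟨(measureUnivNNReal mu : ℝ) ^ (2 : ENNReal).toReal⁻¹ * C, fun f => ?_⟩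
    rw [mul_assoc]
    refine Lp.norm_le_of_ae_bound (by positivity) ?_
    filter_upwards [(memLp_of_continuous (continuous_primFun f)).coeFn_toLp] with x hx
    exact (congrArg norm hx).trans_le ((norm_primFun_le f x).trans (hC f))

theorem prim_coeFn (f : L2) : prim f =ᵐ[mu] primFun f :=
  (memLp_of_continuous (continuous_primFun f)).coeFn_toLp

/-- A test function as an element of `L²(-1, 1)`. -/
def IsTest.toL2 {φ : ℝ → ℝ} (h : IsTest φ) : L2 :=
  (memLp_of_continuous (f := fun x => (φ x : ℂ))
    (Complex.continuous_ofReal.comp h.1.continuous)).toLp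

theorem IsTest.toL2_coeFn {φ : ℝ → ℝ} (h : IsTest φ) : h.toL2 =ᵐ[mu] fun x => (φ x : ℂ) :=
  MemLp.coeFn_toLp _

theorem IsTest.inner_toL2 {φ : ℝ → ℝ} (h : IsTest φ) (f : L2) :
    inner ℂ h.toL2 f = ∫ x, φ x • f x ∂mu := by
  rw [L2.inner_def]
  refine integral_congr_ae (h.toL2_coeFn.mono fun x hx => ?_)
  simp only [hx, RCLike.inner_apply, Complex.conj_ofReal, Complex.real_smul, mul_comm]

theorem isWeakDeriv_iff {f g : L2} : IsWeakDeriv f g ↔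
    ∀ (φ : ℝ → ℝ) (h : IsTest φ), inner ℂ h.deriv_test.toL2 f = -inner ℂ h.toL2 g := by
  refine forall₂_congr fun φ h => ?_
  rw [h.inner_toL2, h.deriv_test.inner_toL2]

theorem IsTest.hasDerivAt_ofReal {φ : ℝ → ℝ} (h : IsTest φ) (x : ℝ) :
    HasDerivAt (fun x => (φ x : ℂ)) ((deriv φ x : ℝ) : ℂ) x :=
  (h.1.differentiable (by simp) x).hasDerivAt.ofReal_comp

theorem IsTest.prim_deriv {φ : ℝ → ℝ} (h : IsTest φ) : prim h.deriv_test.toL2 = h.toL2 := by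
  apply Lp.ext
  refine (prim_coeFn _).trans (EventuallyEq.trans ?_ h.toL2_coeFn.symm)
  apply ae_mu_of_forall_mem
  intro x hx
  rw [primFun_eq_of_mem _ (Ioo_subset_Icc_self hx)]
  have e : ∫ t in (-1 : ℝ)..x, h.deriv_test.toL2 t = ∫ t in (-1 : ℝ)..x, ((deriv φ t : ℝ) : ℂ) := by
    apply intervalIntegral.integral_congr_ae
    have := (ae_restrict_iff' measurableSet_Ioo).1 h.deriv_test.toL2_coeFn
    filter_upwards [this] with t ht ht2
    rw [uIoc_of_le hx.1.le] at ht2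
    exact ht ⟨ht2.1, ht2.2.trans_lt hx.2⟩
  rw [e, intervalIntegral.integral_eq_sub_of_hasDerivAt (fun t _ => h.hasDerivAt_ofReal t)
    ((Complex.continuous_ofReal.comp h.deriv_test.1.continuous).intervalIntegrable _ _)]
  have : φ (-1) = 0 := image_eq_zero_of_notMem_tsupport fun hh => by simpa using h.2.2 hh
  rw [this, Complex.ofReal_zero, sub_zero]

/-- The derivatives of test functions. -/
def testDerivs : Submodule ℂ L2 :=
  Submodule.span ℂ {f | ∃ (φ : ℝ → ℝ) (h : IsTest φ), f = h.deriv_test.toL2}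

/-- The derivatives of test functions are dense in the space of functions of mean zero. -/
theorem mem_closure_testDerivs {f : L2} (hf : inner ℂ one f = 0) :
    f ∈ testDerivs.topologicalClosure := by
  rw [← Submodule.orthogonal_orthogonal_eq_closure]
  intro g hg
  -- Orthogonality to all `φ'` says that `g` has weak derivative `0`, so `g` is constant and hence
  -- orthogonal to `f`.
  have hg0 : IsWeakDeriv g 0 := by
    rw [isWeakDeriv_iff]
    intro φ h
    rw [inner_zero_right, neg_zero]
    exact hg _ (Submodule.subset_span ⟨φ, h, rfl⟩)
  obtain ⟨C, hC⟩ := hg0.const_of_zero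
  have : g = C • one := by
    apply Lp.ext
    refine hC.trans ?_
    filter_upwards [Lp.coeFn_smul C one, one_coeFn] with x h1 h2
    rw [h1, Pi.smul_apply, h2, smul_eq_mul, mul_one]
  rw [this, inner_smul_left, hf, mul_zero]

/-- Density principle behind the integrations by parts: an identity that is linear and continuous in
`f` need only be checked on `f = φ'`. -/
theorem eq_zero_of_testDerivs (l : L2 →L[ℂ] ℂ)
    (h : ∀ (φ : ℝ → ℝ) (h : IsTest φ), l h.deriv_test.toL2 = 0) {f : L2}
    (hf : inner ℂ one f = 0) : l f = 0 := by
  have h1 : testDerivs ≤ LinearMap.ker (l : L2 →ₗ[ℂ] ℂ) := by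
    refine Submodule.span_le.2 ?_
    rintro _ ⟨φ, hφ, rfl⟩
    exact h φ hφ
  have h2 := Submodule.topologicalClosure_minimal _ h1 l.isClosed_ker
  exact h2 (mem_closure_testDerivs hf)

theorem inner_one_one : inner ℂ one one = 2 := by
  rw [inner_one, integral_congr_ae one_coeFn, integral_const]
  norm_num [Measure.real]

/-- The projection onto the functions of mean zero. -/
def meanFree : L2 →L[ℂ] L2 :=
  ContinuousLinearMap.id ℂ L2 - ((2⁻¹ : ℂ) • innerSL ℂ one).smulRight one

theorem meanFree_apply (f : L2) : meanFree f = f - (2⁻¹ * inner ℂ one f) • one := rfl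

theorem inner_one_meanFree (f : L2) : inner ℂ one (meanFree f) = 0 := by
  rw [meanFree_apply, inner_sub_right, inner_smul_right, inner_one_one]
  ring

/-- Split `f` into its mean free part and a constant. The constant has an explicit primitive; for
the mean free part, density reduces to `f = ψ'`, where `prim f = ψ` is smooth. -/
theorem isWeakDeriv_prim (f : L2) : IsWeakDeriv (prim f) f := by
  have h1 : IsWeakDeriv (prim one) one := by
    refine isWeakDeriv_of_glue (f₁ := fun x => ((x + 1 : ℝ) : ℂ)) (f₂ := fun x => ((x + 1 : ℝ) : ℂ))
      (g₁ := fun _ => 1) (g₂ := fun _ => 1)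
      (fun x => by simpa using ((hasDerivAt_id x).add_const 1).ofReal_comp)
      (fun x => by simpa using ((hasDerivAt_id x).add_const 1).ofReal_comp)
      continuous_const continuous_const rfl ?_ ?_
    · rw [glue_self]
      refine (prim_coeFn _).trans (ae_mu_of_forall_mem fun x hx => ?_)
      rw [primFun_eq_of_mem _ (Ioo_subset_Icc_self hx)]
      have e : ∫ t in (-1 : ℝ)..x, one t = ∫ t in (-1 : ℝ)..x, (1 : ℂ) := by
        apply intervalIntegral.integral_congr_ae
        have := (ae_restrict_iff' measurableSet_Ioo).1 one_coeFn
        filter_upwards [this] with t ht ht2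
        rw [uIoc_of_le hx.1.le] at ht2
        exact ht ⟨ht2.1, ht2.2.trans_lt hx.2⟩
      rw [e, intervalIntegral.integral_const]
      simp
    · rw [glue_self]
      exact one_coeFn
  have h2 : ∀ g : L2, inner ℂ one g = 0 → IsWeakDeriv (prim g) g := by
    intro g hg
    rw [isWeakDeriv_iff]
    intro φ hφ
    have := eq_zero_of_testDerivs (innerSL ℂ hφ.deriv_test.toL2 ∘L prim + innerSL ℂ hφ.toL2)
      (fun ψ hψ => by
        change inner ℂ hφ.deriv_test.toL2 (prim hψ.deriv_test.toL2) +
          inner ℂ hφ.toL2 hψ.deriv_test.toL2 = 0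
        rw [hψ.prim_deriv, ← eq_neg_iff_add_eq_zero]
        refine isWeakDeriv_iff.1 (isWeakDeriv_of_glue hψ.hasDerivAt_ofReal hψ.hasDerivAt_ofReal
          (Complex.continuous_ofReal.comp hψ.deriv_test.1.continuous)
          (Complex.continuous_ofReal.comp hψ.deriv_test.1.continuous) rfl ?_ ?_) φ hφ
        · rw [glue_self]
          exact hψ.toL2_coeFn
        · rw [glue_self]
          exact hψ.deriv_test.toL2_coeFn) hg
    rw [eq_neg_iff_add_eq_zero]
    exact this
  have h3 := (h2 (meanFree f) (inner_one_meanFree f)).add (h1.smul (2⁻¹ * inner ℂ one f))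
  rw [← map_smul, ← map_add, meanFree_apply, sub_add_cancel] at h3
  exact h3

theorem prim_mem_H10 {f : L2} (hf : inner ℂ one f = 0) : prim f ∈ H10 :=
  ⟨⟨f, isWeakDeriv_prim f⟩, primFun f, (continuous_primFun f).continuousOn, prim_coeFn f,
    primFun_neg_one f, by rw [primFun_one, ← inner_one, hf]⟩

theorem weakDeriv_eq {f : H1} {g : L2} (h : IsWeakDeriv f g) : weakDeriv f = g :=
  (weakDeriv_spec f).unique h

theorem weakDeriv₀_spec (f : H10) : IsWeakDeriv f (weakDeriv₀ f) :=
  weakDeriv_spec (Submodule.inclusion H10_le_H1 f)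

theorem weakDeriv₀_eq {f : H10} {g : L2} (h : IsWeakDeriv f g) : weakDeriv₀ f = g :=
  (weakDeriv₀_spec f).unique h

/-- The primitive of `f_x` differs from `f` by a constant on `[-1, 1]`. The boundary value at `-1`
makes the constant `0`; the one at `1` then says that `f_x` has mean zero. -/
theorem prim_weakDeriv₀_and_inner_one (f : H10) :
    prim (weakDeriv₀ f) = f ∧ inner ℂ one (weakDeriv₀ f) = 0 := by
  obtain ⟨f, hf, F, F1, F2, F3, F4⟩ := f
  set g := weakDeriv₀ ⟨f, hf, F, F1, F2, F3, F4⟩ with hg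
  have h1 : IsWeakDeriv f g := weakDeriv₀_spec ⟨f, hf, F, F1, F2, F3, F4⟩
  have h2 : IsWeakDeriv (prim g + (-1 : ℂ) • f) 0 := by
    have := (isWeakDeriv_prim g).add (h1.smul (-1))
    rwa [neg_one_smul ℂ g, add_neg_cancel] at this
  obtain ⟨C, hC⟩ := h2.const_of_zero
  have h3 : (fun x => primFun g x - F x) =ᵐ[mu] fun _ => C := by
    filter_upwards [hC, Lp.coeFn_add (prim g) ((-1 : ℂ) • f), Lp.coeFn_smul (-1 : ℂ) f,
      prim_coeFn g, F2] with x e1 e2 e3 e4 e5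
    rw [← e1, e2, Pi.add_apply, e3, Pi.smul_apply, e4, e5, neg_one_smul, sub_eq_add_neg]
  have hEq : EqOn (fun x => primFun g x - F x) (fun _ => C) (Icc (-1) 1) := by
    have h1 : (fun x => primFun g x - F x) =ᵐ[volume.restrict (Icc (-1 : ℝ) 1)] fun _ => C := by
      rwa [Measure.restrict_congr_set Ioo_ae_eq_Icc.symm]
    exact Measure.eqOn_Icc_of_ae_eq volume (by norm_num) h1
      ((continuous_primFun g).continuousOn.sub F1) continuousOn_const
  have hC0 : C = 0 := by
    have := hEq (x := -1) ⟨le_rfl, by norm_num⟩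
    simp only [primFun_neg_one, F3, sub_zero] at this
    exact this.symm
  constructor
  · apply Lp.ext
    filter_upwards [h3, prim_coeFn g, F2] with x e1 e2 e3
    rw [e2, e3]
    rw [hC0] at e1
    exact sub_eq_zero.1 e1
  · have := hEq (x := 1) ⟨by norm_num, le_rfl⟩
    simp only [F4, sub_zero, hC0, primFun_one] at this
    rw [inner_one, this]

theorem prim_weakDeriv₀ (f : H10) : prim (weakDeriv₀ f) = f := (prim_weakDeriv₀_and_inner_one f).1

theorem inner_one_weakDeriv₀ (f : H10) : inner ℂ one (weakDeriv₀ f) = 0 :=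
  (prim_weakDeriv₀_and_inner_one f).2

/-- Integration by parts. -/
theorem inner_weakDeriv (f : H1) (g : H10) :
    inner ℂ (weakDeriv f) (g : L2) = -inner ℂ (f : L2) (weakDeriv₀ g) := by
  -- Written in terms of `g_x`, with `g = prim g_x`, the identity is continuous; for `g_x = φ'` it
  -- is the definition of the weak derivative, up to conjugation.
  have h := eq_zero_of_testDerivs (innerSL ℂ (weakDeriv f) ∘L prim + innerSL ℂ (f : L2))
    (fun φ hφ => by
      change inner ℂ (weakDeriv f) (prim hφ.deriv_test.toL2) +
        inner ℂ (f : L2) hφ.deriv_test.toL2 = 0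
      have h1 := isWeakDeriv_iff.1 (weakDeriv_spec f) φ hφ
      rw [hφ.prim_deriv, ← inner_conj_symm, ← inner_conj_symm (f : L2), h1, map_neg,
        add_neg_cancel]) (inner_one_weakDeriv₀ g)
  change inner ℂ (weakDeriv f) (prim (weakDeriv₀ g)) + inner ℂ (f : L2) (weakDeriv₀ g) = 0 at h
  rwa [prim_weakDeriv₀, ← eq_neg_iff_add_eq_zero] at h

end Primitive

/-! ### Completeness of the energy space -/

section EnergySpace

variable {p : Params}

theorem Energy.inner_eq (x y : Energy p) :
    inner ℂ x y = inner ℂ (weakDeriv₀ (Energy.u1 x)) (weakDeriv₀ (Energy.u1 y)) +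
      (p.c : ℂ) * inner ℂ (weakDeriv₀ (Energy.v1 x)) (weakDeriv₀ (Energy.v1 y)) +
      inner ℂ (Energy.u2 x) (Energy.u2 y) + inner ℂ (Energy.v2 x) (Energy.v2 y) := rfl

theorem re_inner_self_L2 (f : L2) : (inner ℂ f f).re = ‖f‖ ^ 2 :=
  (norm_sq_eq_re_inner (𝕜 := ℂ) f).symm

theorem Energy.norm_sq_eq (x : Energy p) :
    ‖x‖ ^ 2 = ‖weakDeriv₀ (Energy.u1 x)‖ ^ 2 + p.c * ‖weakDeriv₀ (Energy.v1 x)‖ ^ 2 +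
      ‖Energy.u2 x‖ ^ 2 + ‖Energy.v2 x‖ ^ 2 := by
  rw [norm_sq_eq_re_inner (𝕜 := ℂ) x, Energy.inner_eq, RCLike.re_eq_complex_re, Complex.add_re,
    Complex.add_re, Complex.add_re, Complex.re_ofReal_mul, re_inner_self_L2, re_inner_self_L2,
    re_inner_self_L2, re_inner_self_L2]

/-- The vector `(u¹ₓ, v¹ₓ, u², v²)`. -/
def gradLin : Energy p →ₗ[ℂ] L2 × L2 × L2 × L2 :=
  (weakDeriv₀ ∘ₗ Energy.u1).prod ((weakDeriv₀ ∘ₗ Energy.v1).prod (Energy.u2.prod Energy.v2))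

theorem gradLin_apply (x : Energy p) : gradLin x =
    (weakDeriv₀ (Energy.u1 x), weakDeriv₀ (Energy.v1 x), Energy.u2 x, Energy.v2 x) := rfl

theorem norm_gradLin_le (x : Energy p) : ‖gradLin x‖ ≤ √(1 + p.c⁻¹) * ‖x‖ := by
  have hc := p.c_pos
  have h := Energy.norm_sq_eq x
  have key : ∀ f : L2, ‖f‖ ^ 2 ≤ (1 + p.c⁻¹) * ‖x‖ ^ 2 → ‖f‖ ≤ √(1 + p.c⁻¹) * ‖x‖ := by
    intro f hf
    have := Real.sqrt_le_sqrt hf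
    rwa [Real.sqrt_sq (norm_nonneg _), Real.sqrt_mul (by positivity),
      Real.sqrt_sq (norm_nonneg _)] at this
  have h1 := sq_nonneg ‖weakDeriv₀ (Energy.u1 x)‖
  have h2 := mul_nonneg hc.le (sq_nonneg ‖weakDeriv₀ (Energy.v1 x)‖)
  have h3 := sq_nonneg ‖Energy.u2 x‖
  have h4 := sq_nonneg ‖Energy.v2 x‖
  have h5 : ‖x‖ ^ 2 ≤ (1 + p.c⁻¹) * ‖x‖ ^ 2 :=
    le_mul_of_one_le_left (sq_nonneg _) (le_add_of_nonneg_right (inv_nonneg.2 hc.le))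
  rw [gradLin_apply, Prod.norm_def, Prod.norm_def, Prod.norm_def]
  refine max_le (key _ (by linarith)) (max_le (key _ ?_)
    (max_le (key _ (by linarith)) (key _ (by linarith))))
  have h6 : p.c⁻¹ * (p.c * ‖weakDeriv₀ (Energy.v1 x)‖ ^ 2) ≤ p.c⁻¹ * ‖x‖ ^ 2 :=
    mul_le_mul_of_nonneg_left (by linarith) (inv_nonneg.2 hc.le)
  rw [inv_mul_cancel_left₀ hc.ne'] at h6
  have := sq_nonneg ‖x‖
  linarith

/-- The product carries the maximum norm, so the four squares contribute `1 + c + 1 + 1`. -/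
theorem norm_le_gradLin (x : Energy p) : ‖x‖ ≤ √(3 + p.c) * ‖gradLin x‖ := by
  have hc := p.c_pos
  have h := Energy.norm_sq_eq x
  have key : ∀ {f : L2}, ‖f‖ ≤ ‖gradLin x‖ → ‖f‖ ^ 2 ≤ ‖gradLin x‖ ^ 2 := fun hf =>
    pow_le_pow_left₀ (norm_nonneg _) hf 2
  have h1 := key (norm_fst_le (gradLin x))
  have h2 := key ((norm_fst_le _).trans (norm_snd_le (gradLin x)))
  have h3 := key ((norm_fst_le _).trans ((norm_snd_le _).trans (norm_snd_le (gradLin x))))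
  have h4 := key ((norm_snd_le _).trans ((norm_snd_le _).trans (norm_snd_le (gradLin x))))
  simp only [gradLin_apply x] at h1 h2 h3 h4
  rw [← gradLin_apply x] at h1 h2 h3 h4
  have h5 := mul_le_mul_of_nonneg_left h2 hc.le
  have h6 : ‖x‖ ^ 2 ≤ (3 + p.c) * ‖gradLin x‖ ^ 2 := by
    rw [h]
    linarith
  have := Real.sqrt_le_sqrt h6
  rwa [Real.sqrt_sq (norm_nonneg _), Real.sqrt_mul (by positivity),
    Real.sqrt_sq (norm_nonneg _)] at this

/-- The embedding `(u¹, v¹, u², v²) ↦ (u¹ₓ, v¹ₓ, u², v²)` of the energy space into `(L²)⁴`. -/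
def grad : Energy p →L[ℂ] L2 × L2 × L2 × L2 := gradLin.mkContinuous _ norm_gradLin_le

theorem isUniformInducing_grad : IsUniformInducing (grad : Energy p →L[ℂ] L2 × L2 × L2 × L2) := by
  have h : AntilipschitzWith (√(3 + p.c)).toNNReal (grad : Energy p →L[ℂ] L2 × L2 × L2 × L2) := by
    apply ContinuousLinearMap.antilipschitz_of_bound
    intro x
    rw [Real.coe_toNNReal _ (Real.sqrt_nonneg _)]
    exact norm_le_gradLin x
  exact h.isUniformInducing grad.uniformContinuous

/-- The map which sends `f` to the element of `H¹₀` whose derivative is the mean free part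
of `f`. -/
def primZero : L2 →ₗ[ℂ] H10 :=
  LinearMap.codRestrict H10 (prim ∘L meanFree : L2 →L[ℂ] L2).toLinearMap
    fun f => prim_mem_H10 (inner_one_meanFree f)

theorem weakDeriv₀_primZero (f : L2) : weakDeriv₀ (primZero f) = meanFree f :=
  weakDeriv₀_eq (isWeakDeriv_prim (meanFree f))

theorem meanFree_eq_self {f : L2} (hf : inner ℂ one f = 0) : meanFree f = f := by
  rw [meanFree_apply, hf, mul_zero, zero_smul, sub_zero]

theorem range_grad : range (grad : Energy p →L[ℂ] L2 × L2 × L2 × L2) =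
    {z | inner ℂ one z.1 = 0 ∧ inner ℂ one z.2.1 = 0} := by
  ext z
  constructor
  · rintro ⟨x, rfl⟩
    exact ⟨inner_one_weakDeriv₀ _, inner_one_weakDeriv₀ _⟩
  · rintro ⟨h1, h2⟩
    refine ⟨Energy.ofComponents (primZero z.1, primZero z.2.1, z.2.2.1, z.2.2.2), ?_⟩
    change (weakDeriv₀ (primZero z.1), weakDeriv₀ (primZero z.2.1), z.2.2.1, z.2.2.2) = z
    rw [weakDeriv₀_primZero, weakDeriv₀_primZero, meanFree_eq_self h1, meanFree_eq_self h2]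

/-- `grad` identifies the energy space with the closed subspace of `(L²)⁴` cut out by two mean zero
conditions. -/
instance : CompleteSpace (Energy p) := by
  rw [completeSpace_iff_isComplete_range isUniformInducing_grad, range_grad]
  apply IsClosed.isComplete
  have h : Continuous fun f : L2 => inner ℂ one f := (innerSL ℂ one).continuous
  exact (isClosed_eq (h.comp continuous_fst) continuous_const).inter
    (isClosed_eq (h.comp (continuous_fst.comp continuous_snd)) continuous_const)

end EnergySpace

/-! ### Dissipativity and bounded inverse of `𝒜` -/

section Operator

variable {p : Params}

/-- Turns the domain conditions into explicit elements of `H¹₀` and `H¹`, so that later arguments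
can name the flux and `v¹ₓ` directly. -/
theorem mem_graph_waveOp_iff {x y : Energy p} : (x, y) ∈ (waveOp p).graph ↔
    ∃ (U V : H10) (F W : H1), (U : L2) = Energy.u2 x ∧ (V : L2) = Energy.v2 x ∧
      (F : L2) = weakDeriv₀ (Energy.u1 x) + dampMul p (weakDeriv₀ U) ∧
      (W : L2) = weakDeriv₀ (Energy.v1 x) ∧ Energy.u1 y = U ∧ Energy.v1 y = V ∧
      Energy.u2 y = weakDeriv F - Energy.v2 x ∧
      Energy.v2 y = (p.c : ℂ) • weakDeriv W + Energy.u2 x := by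
  rw [LinearPMap.mem_graph_iff]
  constructor
  · rintro ⟨z, hz, hzy⟩
    change (z : Energy p) = x at hz
    change waveOp p z = y at hzy
    subst hz hzy
    exact ⟨domU2 z, domV2 z, domFlux z, domV1x z, rfl, rfl, rfl, rfl, rfl, rfl, rfl, rfl⟩
  · rintro ⟨U, V, F, W, h1, h2, h3, h4, h5, h6, h7, h8⟩
    have hU : (⟨Energy.u2 x, h1 ▸ U.2⟩ : H10) = U := Subtype.ext h1.symm
    have hx : x ∈ waveDomain p := ⟨h1 ▸ U.2, h2 ▸ V.2, h4 ▸ W.2, by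
      rw [hU, ← h3]
      exact F.2⟩
    refine ⟨⟨x, hx⟩, rfl, ?_⟩
    have eF : domFlux ⟨x, hx⟩ = F := by
      apply Subtype.ext
      rw [h3, ← hU]
      rfl
    have eW : domV1x ⟨x, hx⟩ = W := by
      apply Subtype.ext
      rw [h4]
      rfl
    apply Energy.ext
    · rw [h5, ← hU]
      rfl
    · rw [h6]
      exact Subtype.ext h2.symm
    · rw [h7, ← eF]
      rfl
    · rw [h8, ← eW]
      rfl

theorem re_inner_dampMul_nonneg (f : L2) : 0 ≤ (inner ℂ f (dampMul p f)).re := by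
  have e : inner ℂ f (dampMul p f) =
      ((∫ x, (Icc (0 : ℝ) 1).indicator (fun _ => p.d) x * ‖f x‖ ^ 2 ∂mu : ℝ) : ℂ) := by
    rw [L2.inner_def, ← integral_complex_ofReal]
    refine integral_congr_ae ((dampMul_coeFn p f).mono fun x hx => ?_)
    simp only [hx, RCLike.inner_apply]
    rw [mul_assoc, Complex.mul_conj, Complex.normSq_eq_norm_sq]
    by_cases h : x ∈ Icc (0 : ℝ) 1 <;> simp [h]
  rw [e, Complex.ofReal_re]
  refine integral_nonneg fun x => mul_nonneg ?_ (sq_nonneg _)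
  exact indicator_nonneg (fun _ _ => p.d_pos.le) x

/-- `𝒜` is dissipative. -/
theorem re_inner_waveOp_nonpos {x y : Energy p} (h : (x, y) ∈ (waveOp p).graph) :
    (inner ℂ x y).re ≤ 0 := by
  obtain ⟨U, V, F, W, h1, h2, h3, h4, h5, h6, h7, h8⟩ := mem_graph_waveOp_iff.1 h
  have hp : ∀ (f : H1) (g : H10), (inner ℂ (g : L2) (weakDeriv f)).re =
      -(inner ℂ (weakDeriv₀ g) (f : L2)).re := by
    intro f g
    rw [← inner_conj_symm, inner_weakDeriv, map_neg, inner_conj_symm, Complex.neg_re]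
  have hs : ∀ f g : L2, (inner ℂ f g).re = (inner ℂ g f).re := fun f g =>
    inner_re_symm (𝕜 := ℂ) f g
  have hd := re_inner_dampMul_nonneg (p := p) (weakDeriv₀ U)
  rw [Energy.inner_eq, h5, h6, h7, h8, ← h1, ← h2, ← h4, inner_sub_right, inner_add_right,
    inner_smul_right]
  simp only [Complex.add_re, Complex.sub_re, Complex.re_ofReal_mul, hp]
  rw [h3, inner_add_right, Complex.add_re, hs (V : L2) U, hs (weakDeriv₀ V) W,
    hs (weakDeriv₀ U) (weakDeriv₀ (Energy.u1 x))]
  -- Integration by parts cancels the elastic terms and the two coupling terms cancel each other;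
  -- what remains is `-Re ⟨u²ₓ, a u²ₓ⟩`.
  linarith

theorem norm_dampMul_le (f : L2) : ‖dampMul p f‖ ≤ p.d * ‖f‖ := by
  refine Lp.norm_le_mul_norm_of_ae_le_mul ((dampMul_coeFn p f).mono fun x hx => ?_)
  rw [hx, norm_mul]
  refine mul_le_mul_of_nonneg_right ?_ (norm_nonneg _)
  have := p.d_pos.le
  by_cases h : x ∈ Icc (0 : ℝ) 1 <;> simp [h, abs_of_nonneg, this]

/-- The inverse of `𝒜`, as a linear map. -/
def waveInvLin (p : Params) : Energy p →ₗ[ℂ] Energy p :=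
  Energy.ofComponents ∘ₗ
    (primZero ∘ₗ (prim.toLinearMap ∘ₗ (Energy.u2 + H10.subtype ∘ₗ Energy.v1) -
        dampMul p ∘ₗ weakDeriv₀ ∘ₗ Energy.u1)).prod
      (((p.c : ℂ)⁻¹ • primZero ∘ₗ prim.toLinearMap ∘ₗ (Energy.v2 - H10.subtype ∘ₗ Energy.u1)).prod
        ((H10.subtype ∘ₗ Energy.u1).prod (H10.subtype ∘ₗ Energy.v1)))

/-- The inverse of `𝒜` in terms of the derivatives of the first two components. -/
def gradInv (p : Params) : (L2 × L2 × L2 × L2) →L[ℂ] L2 × L2 × L2 × L2 :=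
  let q₁ := ContinuousLinearMap.fst ℂ L2 (L2 × L2 × L2)
  let r := ContinuousLinearMap.snd ℂ L2 (L2 × L2 × L2)
  let q₂ := ContinuousLinearMap.fst ℂ L2 (L2 × L2) ∘L r
  let q₃ := ContinuousLinearMap.fst ℂ L2 L2 ∘L ContinuousLinearMap.snd ℂ L2 (L2 × L2) ∘L r
  let q₄ := ContinuousLinearMap.snd ℂ L2 L2 ∘L ContinuousLinearMap.snd ℂ L2 (L2 × L2) ∘L r
  (meanFree ∘L (prim ∘L (q₃ + prim ∘L q₂) -
    (dampMul p).mkContinuous p.d norm_dampMul_le ∘L q₁)).prod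
    (((p.c : ℂ)⁻¹ • meanFree ∘L prim ∘L (q₄ - prim ∘L q₁)).prod
      ((prim ∘L q₁).prod (prim ∘L q₂)))

/-- Seen through `grad`, the inverse is a composition of bounded operators on `L²`; since `grad` is
inducing, this yields its continuity. -/
theorem grad_waveInvLin (x : Energy p) : grad (waveInvLin p x) = gradInv p (grad x) := by
  have e1 := weakDeriv₀_primZero (prim (Energy.u2 x + (Energy.v1 x : L2)) -
    dampMul p (weakDeriv₀ (Energy.u1 x)))
  have e2 := weakDeriv₀_primZero (prim (Energy.v2 x - (Energy.u1 x : L2)))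
  have e3 : weakDeriv₀ ((p.c : ℂ)⁻¹ • primZero (prim (Energy.v2 x - (Energy.u1 x : L2)))) =
      (p.c : ℂ)⁻¹ • meanFree (prim (Energy.v2 x - (Energy.u1 x : L2))) := by
    rw [map_smul, e2]
  have f1 := prim_weakDeriv₀ (Energy.u1 x)
  have f2 := prim_weakDeriv₀ (Energy.v1 x)
  refine Prod.ext (e1.trans ?_) (Prod.ext (e3.trans ?_) (Prod.ext f1.symm f2.symm))
  · rw [← f2]
    rfl
  · rw [← f1]
    rfl

/-- The bounded inverse of `𝒜`. -/
def waveInv (p : Params) : Energy p →L[ℂ] Energy p where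
  toLinearMap := waveInvLin p
  cont := by
    rw [isUniformInducing_grad.isInducing.continuous_iff]
    have h : ⇑(grad : Energy p →L[ℂ] _) ∘ ⇑(waveInvLin p) = ⇑(gradInv p) ∘ ⇑grad :=
      funext grad_waveInvLin
    change Continuous (⇑(grad : Energy p →L[ℂ] _) ∘ ⇑(waveInvLin p))
    rw [h]
    exact (gradInv p).continuous.comp grad.continuous

theorem isWeakDeriv_one : IsWeakDeriv one 0 := by
  refine isWeakDeriv_of_glue (f₁ := fun _ => 1) (f₂ := fun _ => 1) (g₁ := fun _ => 0)
    (g₂ := fun _ => 0) (fun x => hasDerivAt_const x 1) (fun x => hasDerivAt_const x 1)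
    continuous_const continuous_const rfl ?_ ?_
  · rw [glue_self]
    exact one_coeFn
  · rw [glue_self]
    exact Lp.coeFn_zero ℂ 2 mu

theorem isWeakDeriv_meanFree_prim (f : L2) : IsWeakDeriv (meanFree (prim f)) f := by
  have := (isWeakDeriv_prim f).add (isWeakDeriv_one.smul (-(2⁻¹ * inner ℂ one (prim f))))
  rw [smul_zero, add_zero, neg_smul, ← sub_eq_add_neg] at this
  exact this

/-- Solving `𝒜 x = y` gives `u²` and `v²` at once, then the flux and `c v¹ₓ` as primitives up to
constants. Subtracting the damping term and taking mean free parts fixes the constants, because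
`u¹ₓ` and `v¹ₓ` must have mean zero. -/
theorem waveInv_mem_graph (y : Energy p) : (waveInv p y, y) ∈ (waveOp p).graph := by
  have hc : (p.c : ℂ) ≠ 0 := Complex.ofReal_ne_zero.2 p.c_pos.ne'
  set g := prim (Energy.u2 y + (Energy.v1 y : L2)) with hg
  set a := dampMul p (weakDeriv₀ (Energy.u1 y)) with ha
  set k := prim (Energy.v2 y - (Energy.u1 y : L2)) with hk
  have hu : weakDeriv₀ (Energy.u1 (waveInv p y)) = meanFree (g - a) := weakDeriv₀_primZero _
  have hv : weakDeriv₀ (Energy.v1 (waveInv p y)) = (p.c : ℂ)⁻¹ • meanFree k := by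
    change weakDeriv₀ ((p.c : ℂ)⁻¹ • primZero k) = _
    rw [map_smul, weakDeriv₀_primZero]
  have hF : IsWeakDeriv (meanFree (g - a) + a) (Energy.u2 y + (Energy.v1 y : L2)) := by
    have h1 := (isWeakDeriv_prim (Energy.u2 y + (Energy.v1 y : L2))).add
      (isWeakDeriv_one.smul (-(2⁻¹ * inner ℂ one (g - a))))
    rw [smul_zero, add_zero, ← hg] at h1
    have e : meanFree (g - a) + a = g + (-(2⁻¹ * inner ℂ one (g - a))) • one := by
      rw [meanFree_apply, neg_smul]
      abel
    rwa [e]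
  have hW : IsWeakDeriv ((p.c : ℂ)⁻¹ • meanFree k)
      ((p.c : ℂ)⁻¹ • (Energy.v2 y - (Energy.u1 y : L2))) :=
    (isWeakDeriv_meanFree_prim _).smul _
  refine mem_graph_waveOp_iff.2 ⟨Energy.u1 y, Energy.v1 y, ⟨_, _, hF⟩, ⟨_, _, hW⟩, rfl, rfl, ?_, ?_,
    rfl, rfl, ?_, ?_⟩
  · rw [hu]
  · rw [hv]
  · rw [weakDeriv_eq hF]
    exact (add_sub_cancel_right _ _).symm
  · rw [weakDeriv_eq hW, smul_inv_smul₀ hc]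
    exact (sub_add_cancel _ _).symm

/-- With `u² = v² = 0` the system decouples into two homogeneous Dirichlet problems, each settled by
integration by parts against its solution. -/
theorem eq_zero_of_mem_graph_waveOp {x : Energy p} (h : (x, 0) ∈ (waveOp p).graph) : x = 0 := by
  obtain ⟨U, V, F, W, h1, h2, h3, h4, h5, h6, h7, h8⟩ := mem_graph_waveOp_iff.1 h
  rw [map_zero] at h5 h6 h7 h8
  rw [← h5, ZeroMemClass.coe_zero] at h1
  rw [← h6, ZeroMemClass.coe_zero] at h2
  rw [← h5, map_zero, map_zero, add_zero] at h3
  rw [← h2, sub_zero] at h7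
  rw [← h1, add_zero, eq_comm, smul_eq_zero_iff_right
    (Complex.ofReal_ne_zero.2 p.c_pos.ne')] at h8
  have e1 := inner_weakDeriv F (Energy.u1 x)
  rw [← h7, inner_zero_left, h3, eq_comm, neg_eq_zero, inner_self_eq_zero] at e1
  have e2 := inner_weakDeriv W (Energy.v1 x)
  rw [h8, inner_zero_left, h4, eq_comm, neg_eq_zero, inner_self_eq_zero] at e2
  apply Energy.ext
  · rw [map_zero]
    exact weakDeriv₀_injective (e1.trans (map_zero _).symm)
  · rw [map_zero]
    exact weakDeriv₀_injective (e2.trans (map_zero _).symm)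
  · rw [map_zero, h1]
  · rw [map_zero, h2]

theorem mem_graph_waveOp_iff_eq_waveInv {x y : Energy p} :
    (x, y) ∈ (waveOp p).graph ↔ x = waveInv p y := by
  refine ⟨fun h => ?_, fun h => h ▸ waveInv_mem_graph y⟩
  have h1 := (waveOp p).graph.sub_mem h (waveInv_mem_graph y)
  rw [Prod.mk_sub_mk, sub_self] at h1
  exact sub_eq_zero.1 (eq_zero_of_mem_graph_waveOp h1)

/-- `𝒜` generates a `C₀`-semigroup. -/
theorem exists_semigroup_waveOp (p : Params) :
    ∃ S : C0Semigroup (Energy p), S.HasGenerator (waveOp p) :=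
  exists_semigroup_of_dissipative (waveOp p) (waveInv p)
    (fun _ _ => mem_graph_waveOp_iff_eq_waveInv)
    (fun y => re_inner_waveOp_nonpos (waveInv_mem_graph y))

end Operator

/-! ### Approximate eigenvectors from the forced first wave -/

section ApproximateEigenvectors

variable {p : Params}

theorem norm_le_two_mul_of_ae_bound {f : L2} {C : ℝ} (hC : 0 ≤ C) (h : ∀ᵐ x ∂mu, ‖f x‖ ≤ C) :
    ‖f‖ ≤ 2 * C := by
  refine (Lp.norm_le_of_ae_bound hC h).trans (mul_le_mul_of_nonneg_right ?_ hC)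
  have h1 : (measureUnivNNReal mu : ℝ) = 2 := by
    rw [measureUnivNNReal, ENNReal.coe_toNNReal_eq_toReal, Measure.restrict_apply_univ,
      Real.volume_Ioo]
    norm_num
  rw [h1]
  calc (2 : ℝ) ^ (2 : ENNReal).toReal⁻¹ ≤ 2 ^ (1 : ℝ) :=
        Real.rpow_le_rpow_of_exponent_le (by norm_num) (by norm_num)
    _ = 2 := Real.rpow_one 2

theorem continuous_sin_mul (k : ℝ) : Continuous fun x : ℝ => Complex.sin (k * x) := by fun_prop

theorem continuous_cos_mul (k : ℝ) : Continuous fun x : ℝ => Complex.cos (k * x) := by fun_prop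

/-- The function `sin (k x)` in `L²(-1, 1)`. -/
def sinL2 (k : ℝ) : L2 := (memLp_of_continuous (continuous_sin_mul k)).toLp

/-- The function `cos (k x)` in `L²(-1, 1)`. -/
def cosL2 (k : ℝ) : L2 := (memLp_of_continuous (continuous_cos_mul k)).toLp

theorem sinL2_coeFn (k : ℝ) : sinL2 k =ᵐ[mu] fun x => Complex.sin (k * x) := MemLp.coeFn_toLp _

theorem cosL2_coeFn (k : ℝ) : cosL2 k =ᵐ[mu] fun x => Complex.cos (k * x) := MemLp.coeFn_toLp _

theorem hasDerivAt_ofReal_mul (k x : ℝ) : HasDerivAt (fun x : ℝ => (k : ℂ) * x) k x := by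
  simpa using (Complex.ofRealCLM.hasDerivAt (x := x)).const_mul (k : ℂ)

theorem hasDerivAt_sin_mul (k x : ℝ) :
    HasDerivAt (fun x : ℝ => Complex.sin (k * x)) (k * Complex.cos (k * x)) x := by
  rw [mul_comm (k : ℂ)]
  exact (Complex.hasDerivAt_sin _).comp x (hasDerivAt_ofReal_mul k x)

theorem hasDerivAt_cos_mul (k x : ℝ) :
    HasDerivAt (fun x : ℝ => Complex.cos (k * x)) (-k * Complex.sin (k * x)) x := by
  have := (Complex.hasDerivAt_cos (k * x)).comp x (hasDerivAt_ofReal_mul k x)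
  rw [neg_mul, mul_comm (k : ℂ), ← neg_mul]
  exact this

theorem isWeakDeriv_sinL2 (k : ℝ) : IsWeakDeriv (sinL2 k) ((k : ℂ) • cosL2 k) := by
  refine isWeakDeriv_of_glue (hasDerivAt_sin_mul k) (hasDerivAt_sin_mul k)
    (continuous_const.mul (continuous_cos_mul k)) (continuous_const.mul (continuous_cos_mul k))
    rfl ?_ ?_
  · rw [glue_self]
    exact sinL2_coeFn k
  · rw [glue_self]
    filter_upwards [Lp.coeFn_smul (k : ℂ) (cosL2 k), cosL2_coeFn k] with x h1 h2
    rw [h1, Pi.smul_apply, h2, smul_eq_mul]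

theorem isWeakDeriv_cosL2 (k : ℝ) : IsWeakDeriv (cosL2 k) (-(k : ℂ) • sinL2 k) := by
  refine isWeakDeriv_of_glue (hasDerivAt_cos_mul k) (hasDerivAt_cos_mul k)
    (continuous_const.mul (continuous_sin_mul k)) (continuous_const.mul (continuous_sin_mul k))
    rfl ?_ ?_
  · rw [glue_self]
    exact cosL2_coeFn k
  · rw [glue_self]
    filter_upwards [Lp.coeFn_smul (-(k : ℂ)) (sinL2 k), sinL2_coeFn k] with x h1 h2
    rw [h1, Pi.smul_apply, h2, smul_eq_mul]

theorem sinL2_mem_H10 {k : ℝ} (hk : Real.sin k = 0) : sinL2 k ∈ H10 := by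
  have h : Complex.sin k = 0 := by
    rw [← Complex.ofReal_sin, hk, Complex.ofReal_zero]
  refine ⟨⟨_, isWeakDeriv_sinL2 k⟩, _, (continuous_sin_mul k).continuousOn, sinL2_coeFn k, ?_, ?_⟩
  · simp [h]
  · simp [h]

theorem norm_sinL2 {k : ℝ} (hk0 : k ≠ 0) (hk : Real.sin k = 0) : ‖sinL2 k‖ = 1 := by
  have e : inner ℂ (sinL2 k) (sinL2 k) = ((∫ x in (-1 : ℝ)..1, Real.sin (k * x) ^ 2 : ℝ) : ℂ) := by
    rw [L2.inner_def, ← intervalIntegral.integral_ofReal, ← integral_mu_eq]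
    refine integral_congr_ae ((sinL2_coeFn k).mono fun x hx => ?_)
    simp only [hx, RCLike.inner_apply]
    rw [← Complex.ofReal_mul, ← Complex.ofReal_sin, Complex.conj_ofReal]
    push_cast
    ring
  have h1 : ∫ x in (-1 : ℝ)..1, Real.sin (k * x) ^ 2 = 1 := by
    rw [intervalIntegral.integral_comp_mul_left (fun x => Real.sin x ^ 2) hk0, integral_sin_sq]
    simp only [mul_neg, mul_one, Real.sin_neg, hk, smul_eq_mul]
    field_simp
    ring
  have h2 := re_inner_self_L2 (sinL2 k)
  rw [e, h1, Complex.ofReal_re] at h2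
  exact (pow_eq_one_iff_of_nonneg (norm_nonneg _) two_ne_zero).1 h2.symm

/-- Solutions of the first resolvent equation which are forced by `sin (k x)`, where `k` is an
eigenfrequency of the undamped wave, yield approximate eigenvectors of `𝒜`. -/
theorem exists_approximate_eigenvector {k l B : ℝ} (hl : 0 < l) (hk0 : k ≠ 0)
    (hk : Real.sin k = 0) (hkl : p.c * k ^ 2 = l ^ 2) {f₁ f₂ g₁ g₂ : ℝ → ℂ}
    (hf₁ : ∀ x, HasDerivAt f₁ (g₁ x) x) (hf₂ : ∀ x, HasDerivAt f₂ (g₂ x) x)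
    (hg₁ : ∀ x : ℝ, HasDerivAt g₁ (Complex.I * Complex.sin (k * x) - l ^ 2 * f₁ x) x)
    (hg₂ : ∀ x : ℝ, HasDerivAt (fun x => (1 + Complex.I * l * p.d) * g₂ x)
      (Complex.I * Complex.sin (k * x) - l ^ 2 * f₂ x) x)
    (h₁ : f₁ (-1) = 0) (h₂ : f₂ 1 = 0) (hf : f₁ 0 = f₂ 0)
    (hg : g₁ 0 = (1 + Complex.I * l * p.d) * g₂ 0) (hB : 0 ≤ B)
    (hB₁ : ∀ x ∈ Icc (-1 : ℝ) 0, ‖f₁ x‖ ≤ B) (hB₂ : ∀ x ∈ Icc (0 : ℝ) 1, ‖f₂ x‖ ≤ B) :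
    ∃ y z : Energy p, (y, z) ∈ (waveOp p).graph ∧ 1 ≤ ‖y‖ ∧
      ‖z - (Complex.I * l) • y‖ ≤ l * (2 * B) := by
  have cf₁ : Continuous f₁ := continuous_iff_continuousAt.2 fun x => (hf₁ x).continuousAt
  have cf₂ : Continuous f₂ := continuous_iff_continuousAt.2 fun x => (hf₂ x).continuousAt
  have cg₁ : Continuous g₁ := continuous_iff_continuousAt.2 fun x => (hg₁ x).continuousAt
  have cg₂' : Continuous fun x => (1 + Complex.I * l * p.d) * g₂ x :=
    continuous_iff_continuousAt.2 fun x => (hg₂ x).continuousAt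
  have hne : (1 + Complex.I * l * p.d : ℂ) ≠ 0 := fun h => by
    have := congrArg Complex.re h
    simp at this
  have cg₂ : Continuous g₂ := by
    have : g₂ = fun x => (1 + Complex.I * l * p.d)⁻¹ * ((1 + Complex.I * l * p.d) * g₂ x) :=
      funext fun x => (inv_mul_cancel_left₀ hne _).symm
    rw [this]
    exact continuous_const.mul cg₂'
  have cs := continuous_sin_mul k
  have hlc : (l : ℂ) ≠ 0 := Complex.ofReal_ne_zero.2 hl.ne'
  let U : L2 := (memLp_glue cf₁ cf₂).toLp
  let Ux : L2 := (memLp_glue cg₁ cg₂).toLp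
  let F : L2 := (memLp_glue cg₁ cg₂').toLp
  have hU : U =ᵐ[mu] glue f₁ f₂ := MemLp.coeFn_toLp _
  have hUx : Ux =ᵐ[mu] glue g₁ g₂ := MemLp.coeFn_toLp _
  have hF : F =ᵐ[mu] glue g₁ fun x => (1 + Complex.I * l * p.d) * g₂ x := MemLp.coeFn_toLp _
  have wU : IsWeakDeriv U Ux := isWeakDeriv_of_glue hf₁ hf₂ cg₁ cg₂ hf hU hUx
  have wF : IsWeakDeriv F (Complex.I • sinL2 k - ((l : ℂ) ^ 2) • U) := by
    refine isWeakDeriv_of_glue hg₁ hg₂ ((continuous_const.mul cs).sub (continuous_const.mul cf₁))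
      ((continuous_const.mul cs).sub (continuous_const.mul cf₂)) hg hF ?_
    filter_upwards [Lp.coeFn_sub (Complex.I • sinL2 k) (((l : ℂ) ^ 2) • U),
      Lp.coeFn_smul Complex.I (sinL2 k), Lp.coeFn_smul ((l : ℂ) ^ 2) U, sinL2_coeFn k, hU]
      with x e1 e2 e3 e4 e5
    rw [e1, Pi.sub_apply, e2, e3, Pi.smul_apply, Pi.smul_apply, e4, e5, smul_eq_mul, smul_eq_mul]
    rcases le_or_gt 0 x with h | h
    · rw [glue_of_nonneg h, glue_of_nonneg h]
    · rw [glue_of_neg h, glue_of_neg h]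
  have mU : U ∈ H10 := by
    refine ⟨⟨_, wU⟩, _, (continuous_glue cf₁ cf₂ hf).continuousOn, hU, ?_, ?_⟩
    · rw [glue_of_neg (by norm_num), h₁]
    · rw [glue_of_nonneg (by norm_num), h₂]
  have mS := sinL2_mem_H10 hk
  let u : H10 := ⟨U, mU⟩
  let v : H10 := (l : ℂ)⁻¹ • ⟨sinL2 k, mS⟩
  have hu : weakDeriv₀ u = Ux := weakDeriv₀_eq wU
  have hv : weakDeriv₀ v = ((l : ℂ)⁻¹ * k) • cosL2 k := by
    rw [map_smul, weakDeriv₀_eq (isWeakDeriv_sinL2 k), smul_smul]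
  have wW := (isWeakDeriv_cosL2 k).smul ((l : ℂ)⁻¹ * k)
  have hIv : (Complex.I * l) • (v : L2) = Complex.I • sinL2 k := by
    change (Complex.I * l) • ((l : ℂ)⁻¹ • sinL2 k) = _
    rw [smul_smul, mul_assoc, mul_inv_cancel₀ hlc, mul_one]
  -- The factor `l⁻¹` in `v` normalises `v² = i l v = i sin (k x)` to norm `1`, which alone gives `1
  -- ≤ ‖y‖`.
  let y : Energy p := Energy.ofComponents (u, v, (Complex.I * l) • (u : L2),
    (Complex.I * l) • (v : L2))
  let z : Energy p := Energy.ofComponents ((Complex.I * l) • u, (Complex.I * l) • v,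
    (Complex.I • sinL2 k - ((l : ℂ) ^ 2) • U) - (Complex.I * l) • (v : L2),
    (p.c : ℂ) • (((l : ℂ)⁻¹ * k) • (-(k : ℂ) • sinL2 k)) + (Complex.I * l) • (u : L2))
  have hyz : (y, z) ∈ (waveOp p).graph := by
    refine mem_graph_waveOp_iff.2 ⟨(Complex.I * l) • u, (Complex.I * l) • v, ⟨F, _, wF⟩,
      ⟨_, _, wW⟩, rfl, rfl, ?_, hv.symm, rfl, rfl, ?_, ?_⟩
    · change F = weakDeriv₀ u + dampMul p (weakDeriv₀ ((Complex.I * l) • u))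
      rw [map_smul, hu]
      apply Lp.ext
      filter_upwards [hF, Lp.coeFn_add Ux (dampMul p ((Complex.I * l) • Ux)), hUx,
        dampMul_coeFn p ((Complex.I * l) • Ux), Lp.coeFn_smul (Complex.I * l) Ux,
        ae_mu_of_forall_mem fun x hx => hx] with x e1 e2 e3 e4 e5 hx
      rw [e1, e2, Pi.add_apply, e4, e5, Pi.smul_apply, e3, smul_eq_mul]
      rcases le_or_gt 0 x with h | h
      · rw [glue_of_nonneg h, glue_of_nonneg h, indicator_of_mem (show x ∈ Icc (0 : ℝ) 1 from
          ⟨h, hx.2.le⟩)]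
        ring
      · rw [glue_of_neg h, glue_of_neg h, indicator_of_notMem (fun hh => (not_le.2 h) hh.1),
          zero_mul, add_zero]
    · rw [weakDeriv_eq wF]
      rfl
    · rw [weakDeriv_eq wW]
      rfl
  refine ⟨y, z, hyz, ?_, ?_⟩
  · have h1 := Energy.norm_sq_eq y
    have h2 : Energy.v2 y = Complex.I • sinL2 k := hIv
    have h3 : ‖Energy.v2 y‖ = 1 := by
      rw [h2, norm_smul, norm_sinL2 hk0 hk, Complex.norm_I, one_mul]
    rw [h3] at h1
    have h4 := sq_nonneg ‖weakDeriv₀ (Energy.u1 y)‖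
    have h5 := mul_nonneg p.c_pos.le (sq_nonneg ‖weakDeriv₀ (Energy.v1 y)‖)
    have h6 := sq_nonneg ‖Energy.u2 y‖
    have h7 : (1 : ℝ) ^ 2 ≤ ‖y‖ ^ 2 := by linarith
    exact (pow_le_pow_iff_left₀ zero_le_one (norm_nonneg _) two_ne_zero).1 h7
  · have e1 : Energy.u1 (z - (Complex.I * l) • y) = 0 := sub_self ((Complex.I * l) • u)
    have e2 : Energy.v1 (z - (Complex.I * l) • y) = 0 := sub_self ((Complex.I * l) • v)
    have e3 : Energy.u2 (z - (Complex.I * l) • y) = 0 := by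
      change (Complex.I • sinL2 k - ((l : ℂ) ^ 2) • U) - (Complex.I * l) • (v : L2) -
        (Complex.I * l) • ((Complex.I * l) • U) = 0
      rw [hIv, smul_smul, show Complex.I * l * (Complex.I * l) = -(l : ℂ) ^ 2 by
        linear_combination (l : ℂ) ^ 2 * Complex.I_sq, neg_smul]
      abel
    -- Since `c k² = l²`, the terms in `v` cancel, and the coupling `i l u` is the whole residual.
    have e4 : Energy.v2 (z - (Complex.I * l) • y) = (Complex.I * l) • U := by
      change (p.c : ℂ) • (((l : ℂ)⁻¹ * k) • (-(k : ℂ) • sinL2 k)) + (Complex.I * l) • U -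
        (Complex.I * l) • ((Complex.I * l) • (v : L2)) = _
      have hkl' : (p.c : ℂ) * k ^ 2 = l ^ 2 := by exact_mod_cast hkl
      have e5 : (p.c : ℂ) * ((l : ℂ)⁻¹ * k) * -(k : ℂ) = Complex.I * l * Complex.I := by
        field_simp
        linear_combination -hkl' - (l : ℂ) ^ 2 * Complex.I_sq
      rw [hIv, smul_smul, smul_smul, smul_smul, e5]
      abel
    have h1 := Energy.norm_sq_eq (z - (Complex.I * l) • y)
    rw [e1, e2, e3, e4, map_zero, norm_zero] at h1
    have h2 : ‖z - (Complex.I * l) • y‖ = ‖(Complex.I * l) • U‖ := by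
      refine (pow_left_inj₀ (norm_nonneg _) (norm_nonneg _) two_ne_zero).1 ?_
      rw [h1]
      ring
    rw [h2, norm_smul, norm_mul, Complex.norm_I, one_mul, Complex.norm_real,
      Real.norm_of_nonneg hl.le]
    refine mul_le_mul_of_nonneg_left (norm_le_two_mul_of_ae_bound hB ?_) hl.le
    filter_upwards [hU, ae_mu_of_forall_mem fun x hx => hx] with x e1 hx
    rw [e1]
    rcases le_or_gt 0 x with h | h
    · rw [glue_of_nonneg h]
      exact hB₂ x ⟨h, hx.2.le⟩
    · rw [glue_of_neg h]
      exact hB₁ x ⟨hx.1.le, h.le⟩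

end ApproximateEigenvectors

/-! ### Size of the decay rate and of the transmission determinant -/

section Coefficients

theorem norm_sinh_le (z : ℂ) : ‖Complex.sinh z‖ ≤ Real.cosh z.re := by
  have h := norm_sub_le (Complex.exp z) (Complex.exp (-z))
  rw [Complex.norm_exp, Complex.norm_exp, Complex.neg_re] at h
  rw [Complex.sinh, norm_div, Complex.norm_ofNat, Real.cosh_eq]
  linarith

theorem sinh_re_le_norm_sinh (z : ℂ) : Real.sinh z.re ≤ ‖Complex.sinh z‖ := by
  have h := norm_sub_norm_le (Complex.exp z) (Complex.exp (-z))
  rw [Complex.norm_exp, Complex.norm_exp, Complex.neg_re] at h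
  rw [Complex.sinh, norm_div, Complex.norm_ofNat, Real.sinh_eq]
  linarith

theorem sinh_re_le_norm_cosh (z : ℂ) : Real.sinh z.re ≤ ‖Complex.cosh z‖ := by
  have h := norm_sub_le_norm_add (Complex.exp z) (Complex.exp (-z))
  rw [Complex.norm_exp, Complex.norm_exp, Complex.neg_re] at h
  rw [Complex.cosh, norm_div, Complex.norm_ofNat, Real.sinh_eq]
  linarith

/-- Equivalent to `3 ≤ e^{2a}`. Together with the bounds above, it keeps `cosh μ / sinh μ` away from
zero once `Re μ ≥ 1`. -/
theorem cosh_le_two_mul_sinh {a : ℝ} (ha : 1 ≤ a) : Real.cosh a ≤ 2 * Real.sinh a := by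
  have h1 : 3 ≤ Real.exp (2 * a) := by linarith [Real.add_one_le_exp (2 * a)]
  have h2 : Real.exp (2 * a) * Real.exp (-a) = Real.exp a := by
    rw [← Real.exp_add]
    congr 1
    ring
  have h3 := mul_le_mul_of_nonneg_right h1 (Real.exp_pos (-a)).le
  rw [Real.cosh_eq, Real.sinh_eq]
  linarith

/-- The decay rate in the damped region. -/
theorem exists_decay_rate {d l : ℝ} (hd : 0 < d) (hl : 0 < l) (hld : 1 ≤ l * d)
    (hl2 : 4 * d + 2 / d ≤ l) :
    ∃ μ : ℂ, (1 + Complex.I * l * d) * μ ^ 2 = -(l : ℂ) ^ 2 ∧ 1 ≤ μ.re := by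
  have hne : (1 + Complex.I * l * d : ℂ) ≠ 0 := fun h => by
    have := congrArg Complex.re h
    simp at this
  obtain ⟨ν, hν⟩ := IsAlgClosed.exists_pow_nat_eq (-(l : ℂ) ^ 2 / (1 + Complex.I * l * d)) two_pos
  obtain ⟨μ, hμ, hre⟩ : ∃ μ : ℂ, μ ^ 2 = -(l : ℂ) ^ 2 / (1 + Complex.I * l * d) ∧ 0 ≤ μ.re := by
    rcases le_total 0 ν.re with h | h
    · exact ⟨ν, hν, h⟩
    · exact ⟨-ν, by rw [neg_sq, hν], by simpa using h⟩
  have heq : (1 + Complex.I * l * d) * μ ^ 2 = -(l : ℂ) ^ 2 := by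
    rw [hμ, mul_div_cancel₀ _ hne]
  refine ⟨μ, heq, ?_⟩
  -- The bound comes from `2 (Re μ)² = |μ|² + Re μ²`, with `|μ|² ≥ l / (2d)` and `Re μ² ≥ -1 / d²`.
  -- The assumption `4 d + 2 / d ≤ l` says exactly that `l / (2d) - 1 / d² ≥ 2`.
  set X := (μ ^ 2).re with hX
  set Y := (μ ^ 2).im with hY
  have e1 : X - l * d * Y = -l ^ 2 := by
    have := congrArg Complex.re heq
    simpa [Complex.mul_re, Complex.add_re, ← Complex.ofReal_pow, ← hX, ← hY] using this
  have e2 : Y + l * d * X = 0 := by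
    have := congrArg Complex.im heq
    simpa [Complex.mul_im, Complex.add_re, ← Complex.ofReal_pow, ← hX, ← hY] using this
  have hXd : -1 ≤ X * d ^ 2 := by
    have e3 : X * (1 + (l * d) ^ 2) = -l ^ 2 := by linear_combination e1 + l * d * e2
    have h1 : 0 < 1 + (l * d) ^ 2 := by positivity
    have h2 : -1 * (1 + (l * d) ^ 2) ≤ X * d ^ 2 * (1 + (l * d) ^ 2) := by
      have : X * d ^ 2 * (1 + (l * d) ^ 2) = -(l * d) ^ 2 := by linear_combination d ^ 2 * e3
      rw [this]
      linarith
    exact le_of_mul_le_mul_right h2 h1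
  have hn : ‖(1 + Complex.I * l * d : ℂ)‖ * ‖μ‖ ^ 2 = l ^ 2 := by
    have := congrArg norm heq
    rwa [norm_mul, norm_pow, norm_neg, norm_pow, Complex.norm_real, Real.norm_of_nonneg hl.le]
      at this
  have hn1 : ‖(1 + Complex.I * l * d : ℂ)‖ ≤ 2 * (l * d) := by
    refine (norm_add_le _ _).trans ?_
    rw [norm_one, norm_mul, norm_mul, Complex.norm_I, Complex.norm_real, Complex.norm_real,
      Real.norm_of_nonneg hl.le, Real.norm_of_nonneg hd.le]
    linarith
  have hn2 : l ≤ 2 * d * ‖μ‖ ^ 2 := by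
    have h1 := mul_le_mul_of_nonneg_right hn1 (sq_nonneg ‖μ‖)
    rw [hn] at h1
    have h2 : l * l ≤ l * (2 * d * ‖μ‖ ^ 2) := by linarith
    exact le_of_mul_le_mul_left h2 hl
  have hmu : ‖μ‖ ^ 2 = μ.re ^ 2 + μ.im ^ 2 := by
    rw [← Complex.normSq_eq_norm_sq, Complex.normSq_apply]
    ring
  have hX2 : X = μ.re ^ 2 - μ.im ^ 2 := by
    rw [hX, sq, Complex.mul_re]
    ring
  have h3 : 4 * d * d + 2 ≤ l * d := by
    have := mul_le_mul_of_nonneg_right hl2 hd.le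
    rwa [add_mul, div_mul_cancel₀ _ hd.ne'] at this
  have h4 : 4 * d ^ 2 ≤ 4 * d ^ 2 * μ.re ^ 2 := by
    have := mul_le_mul_of_nonneg_right hn2 hd.le
    nlinarith
  have h5 : 1 ≤ μ.re ^ 2 := by
    have h6 : 0 < 4 * d ^ 2 := by positivity
    exact le_of_mul_le_mul_left (by linarith) h6
  nlinarith

variable {d k l : ℝ}

/-- With `D = 1 + i l d`, one has `|D μ|² = |D| |D μ²| = |D| l²` and `|D| ≥ l d`. -/
theorem norm_damp_mul_rate_ge {μ : ℂ} (hd : 0 < d) (hl : 0 < l)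
    (h : (1 + Complex.I * l * d) * μ ^ 2 = -(l : ℂ) ^ 2) :
    l * √(l * d) ≤ ‖(1 + Complex.I * l * d) * μ‖ := by
  have hn : ‖(1 + Complex.I * l * d : ℂ)‖ * ‖μ‖ ^ 2 = l ^ 2 := by
    have := congrArg norm h
    rwa [norm_mul, norm_pow, norm_neg, norm_pow, Complex.norm_real, Real.norm_of_nonneg hl.le]
      at this
  have h1 : l * d ≤ ‖(1 + Complex.I * l * d : ℂ)‖ := by
    have := Complex.abs_im_le_norm (1 + Complex.I * l * d)
    simp only [Complex.add_im, Complex.one_im, Complex.mul_im, Complex.mul_re, Complex.I_re,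
      Complex.I_im, Complex.ofReal_re, Complex.ofReal_im] at this
    refine le_trans (le_of_eq ?_) this
    rw [abs_of_nonneg] <;> ring_nf
    positivity
  refine (pow_le_pow_iff_left₀ (by positivity) (norm_nonneg _) two_ne_zero).1 ?_
  rw [mul_pow, Real.sq_sqrt (by positivity), norm_mul, mul_pow, sq ‖(1 + Complex.I * l * d : ℂ)‖,
    mul_assoc, hn, mul_comm]
  exact mul_le_mul_of_nonneg_right h1 (sq_nonneg l)

/-- The determinant of the transmission conditions at `0` is large unless `l` is close to a
resonance. -/
theorem norm_transmission_ge {μ : ℂ} (hd : 0 < d) (hl : 0 < l)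
    (h : (1 + Complex.I * l * d) * μ ^ 2 = -(l : ℂ) ^ 2) (hμ : 1 ≤ μ.re)
    (hs : 4 ≤ √(l * d) * |Real.sin l|) :
    l ≤ ‖l * Complex.cos l + (1 + Complex.I * l * d) * μ * (Complex.cosh μ / Complex.sinh μ) *
      Complex.sin l‖ := by
  have hsinh : 0 < Real.sinh μ.re := Real.sinh_pos_iff.2 (by linarith)
  have h0 : 0 < ‖Complex.sinh μ‖ := hsinh.trans_le (sinh_re_le_norm_sinh μ)
  have h1 : 1 / 2 ≤ ‖Complex.cosh μ / Complex.sinh μ‖ := by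
    rw [norm_div, le_div_iff₀ h0]
    linarith [norm_sinh_le μ, cosh_le_two_mul_sinh hμ, sinh_re_le_norm_cosh μ]
  have h2 := norm_damp_mul_rate_ge hd hl h
  have h3 : ‖Complex.sin (l : ℂ)‖ = |Real.sin l| := by
    rw [← Complex.ofReal_sin, Complex.norm_real, Real.norm_eq_abs]
  have h4 : ‖(l : ℂ) * Complex.cos l‖ ≤ l := by
    rw [← Complex.ofReal_cos, norm_mul, Complex.norm_real, Complex.norm_real,
      Real.norm_of_nonneg hl.le, Real.norm_eq_abs]
    exact mul_le_of_le_one_right hl.le (Real.abs_cos_le_one l)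
  -- The constant `4` is chosen here: the factor `1 / 2` from `cosh μ / sinh μ` leaves `2 l`, of
  -- which `l cos l` can cancel at most `l`.
  have h5 : 2 * l ≤ ‖(1 + Complex.I * l * d) * μ * (Complex.cosh μ / Complex.sinh μ) *
      Complex.sin l‖ := by
    rw [norm_mul, norm_mul, h3]
    calc 2 * l = l * (1 / 2) * 4 := by ring
      _ ≤ l * (1 / 2) * (√(l * d) * |Real.sin l|) := by gcongr
      _ = l * √(l * d) * (1 / 2) * |Real.sin l| := by ring
      _ ≤ _ := by gcongr
  have h6 := norm_sub_le_norm_add ((1 + Complex.I * l * d) * μ *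
    (Complex.cosh μ / Complex.sinh μ) * Complex.sin l) (l * Complex.cos l)
  rw [add_comm (_ * Complex.sin (l : ℂ))] at h6
  linarith

theorem norm_ofReal_sin_le (x : ℝ) : ‖Complex.sin (x : ℂ)‖ ≤ 1 := by
  rw [← Complex.ofReal_sin, Complex.norm_real, Real.norm_eq_abs]
  exact Real.abs_sin_le_one x

end Coefficients

/-! ### Explicit forced solution and contradiction with the resolvent bound -/

section Instability

variable {p : Params}

/-- Away from the resonances of the first wave, `𝒜` has approximate eigenvectors close to the
eigenfunctions of the second wave. -/
theorem exists_approximate_eigenvector_of_sin {k l : ℝ} (hk0 : 0 < k) (hkl : p.c * k ^ 2 = l ^ 2)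
    (hlt : k < l) (hk : Real.sin k = 0) (hld : 1 ≤ l * p.d)
    (hl2 : 4 * p.d + 2 / p.d ≤ l) (hs : 4 ≤ √(l * p.d) * |Real.sin l|) :
    ∃ y z : Energy p, (y, z) ∈ (waveOp p).graph ∧ 1 ≤ ‖y‖ ∧ ‖z - (Complex.I * l) • y‖ ≤
      l * (2 * (1 / (l ^ 2 - k ^ 2) + 2 * ((2 / k + k / (l ^ 2 - k ^ 2)) / l))) := by
  have hd := p.d_pos
  have hl : 0 < l := hk0.trans hlt
  have hE : 0 < l ^ 2 - k ^ 2 := by nlinarith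
  obtain ⟨μ, hμ, hμre⟩ := exists_decay_rate hd hl hld hl2
  have hbr := norm_transmission_ge hd hl hμ hμre hs
  set D : ℂ := 1 + Complex.I * l * p.d with hD
  set T : ℂ := l * Complex.cos l + D * μ * (Complex.cosh μ / Complex.sinh μ) * Complex.sin l with hT
  have hT0 : T ≠ 0 := norm_pos_iff.1 (hl.trans_le hbr)
  have hsinh : 0 < Real.sinh μ.re := Real.sinh_pos_iff.2 (by linarith)
  have hsh : 0 < ‖Complex.sinh μ‖ := hsinh.trans_le (sinh_re_le_norm_sinh μ)
  have hsh0 : Complex.sinh μ ≠ 0 := norm_pos_iff.1 hsh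
  have hEc : ((l : ℂ) ^ 2 - k ^ 2) ≠ 0 := by
    have := Complex.ofReal_ne_zero.2 hE.ne'
    push_cast at this
    exact this
  have hQre : ((l : ℂ) ^ 2 - D * k ^ 2).re = l ^ 2 - k ^ 2 := by
    simp [hD, ← Complex.ofReal_pow, Complex.mul_re]
  have hQim : ((l : ℂ) ^ 2 - D * k ^ 2).im = -(l * p.d * k ^ 2) := by
    simp [hD, ← Complex.ofReal_pow, Complex.mul_im]
  have hQ1 : l ^ 2 - k ^ 2 ≤ ‖(l : ℂ) ^ 2 - D * k ^ 2‖ := by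
    rw [← hQre]
    exact (le_abs_self _).trans (Complex.abs_re_le_norm _)
  have hQ2 : l * p.d * k ^ 2 ≤ ‖(l : ℂ) ^ 2 - D * k ^ 2‖ := by
    have := Complex.abs_im_le_norm ((l : ℂ) ^ 2 - D * k ^ 2)
    rw [hQim, abs_neg] at this
    exact (le_abs_self _).trans this
  have hQ0 : ((l : ℂ) ^ 2 - D * k ^ 2) ≠ 0 := norm_pos_iff.1 (hE.trans_le hQ1)
  -- `β` and `γ` are the amplitudes of the particular solutions on the undamped and the damped half.
  -- Continuity at `0` gives `δ sinh μ = α sin l`; flux continuity then gives `α T = D γ k - k β`.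
  set β : ℂ := Complex.I / ((l : ℂ) ^ 2 - k ^ 2) with hβ
  set γ : ℂ := Complex.I / ((l : ℂ) ^ 2 - D * k ^ 2) with hγ
  set α : ℂ := (D * γ * k - k * β) / T with hα
  set δ : ℂ := α * Complex.sin l / Complex.sinh μ with hδ
  have eβ : β * ((l : ℂ) ^ 2 - k ^ 2) = Complex.I := div_mul_cancel₀ _ hEc
  have eγ : γ * ((l : ℂ) ^ 2 - D * k ^ 2) = Complex.I := div_mul_cancel₀ _ hQ0
  have eα : α * T = D * γ * k - k * β := div_mul_cancel₀ _ hT0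
  have eδ : δ * Complex.sinh μ = α * Complex.sin l := div_mul_cancel₀ _ hsh0
  have nβ : ‖β‖ = 1 / (l ^ 2 - k ^ 2) := by
    rw [hβ, norm_div, Complex.norm_I, ← Complex.ofReal_pow, ← Complex.ofReal_pow,
      ← Complex.ofReal_sub, Complex.norm_real, Real.norm_of_nonneg hE.le]
  have nγ1 : ‖γ‖ ≤ 1 / (l ^ 2 - k ^ 2) := by
    rw [hγ, norm_div, Complex.norm_I]
    exact one_div_le_one_div_of_le hE hQ1
  -- A second bound on `γ`, from the imaginary part of the denominator: it absorbs the growth of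
  -- `D`, so that `D γ k` is at most `2 / k`.
  have nγ2 : ‖γ‖ ≤ 1 / (l * p.d * k ^ 2) := by
    rw [hγ, norm_div, Complex.norm_I]
    exact one_div_le_one_div_of_le (by positivity) hQ2
  have nD : ‖D‖ ≤ 2 * (l * p.d) := by
    refine (norm_add_le _ _).trans ?_
    rw [norm_one, norm_mul, norm_mul, Complex.norm_I, Complex.norm_real, Complex.norm_real,
      Real.norm_of_nonneg hl.le, Real.norm_of_nonneg hd.le]
    linarith
  have nk : ‖(k : ℂ)‖ = k := by rw [Complex.norm_real, Real.norm_of_nonneg hk0.le]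
  have nα : ‖α‖ ≤ (2 / k + k / (l ^ 2 - k ^ 2)) / l := by
    rw [hα, norm_div]
    refine div_le_div₀ (by positivity) ?_ hl hbr
    refine (norm_sub_le _ _).trans (add_le_add ?_ ?_)
    · rw [norm_mul, norm_mul, nk]
      calc ‖D‖ * ‖γ‖ * k ≤ 2 * (l * p.d) * (1 / (l * p.d * k ^ 2)) * k := by gcongr
        _ = 2 / k := by field_simp
    · rw [norm_mul, nk, nβ, mul_one_div]
  -- Both `δ` and `sinh (μ (1 - x))` depend on the unbounded size of `μ`; only their product is
  -- controlled, through `δ sinh μ = α sin l`.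
  have nδ : ∀ x ∈ Icc (0 : ℝ) 1, ‖δ * Complex.sinh (μ * (1 - x))‖ ≤ 2 * ‖α‖ := by
    intro x hx
    have h1 := norm_sinh_le (μ * (1 - x))
    have h2 : (μ * (1 - x)).re = μ.re * (1 - x) := by
      rw [← Complex.ofReal_one, ← Complex.ofReal_sub, Complex.re_mul_ofReal]
    have h3 : Real.cosh (μ.re * (1 - x)) ≤ Real.cosh μ.re := by
      rw [Real.cosh_le_cosh, abs_of_nonneg (mul_nonneg (by linarith) (by linarith [hx.2])),
        abs_of_nonneg (by linarith)]
      exact mul_le_of_le_one_right (by linarith) (by linarith [hx.1])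
    have h4 : ‖Complex.sinh (μ * (1 - x))‖ ≤ 2 * ‖Complex.sinh μ‖ := by
      rw [h2] at h1
      linarith [cosh_le_two_mul_sinh hμre, sinh_re_le_norm_sinh μ]
    rw [norm_mul]
    calc ‖δ‖ * ‖Complex.sinh (μ * (1 - x))‖ ≤ ‖δ‖ * (2 * ‖Complex.sinh μ‖) := by gcongr
      _ = 2 * ‖δ * Complex.sinh μ‖ := by rw [norm_mul]; ring
      _ = 2 * (‖α‖ * ‖Complex.sin (l : ℂ)‖) := by rw [eδ, norm_mul]
      _ ≤ 2 * (‖α‖ * 1) := by gcongr; exact norm_ofReal_sin_le l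
      _ = 2 * ‖α‖ := by ring
  have hshift : ∀ x : ℝ, HasDerivAt (fun x : ℝ => (l : ℂ) * (x + 1)) l x := fun x => by
    simpa using ((Complex.ofRealCLM.hasDerivAt (x := x)).add_const (1 : ℂ)).const_mul (l : ℂ)
  have hrefl : ∀ x : ℝ, HasDerivAt (fun x : ℝ => μ * (1 - x)) (-μ) x := fun x => by
    simpa using ((Complex.ofRealCLM.hasDerivAt (x := x)).const_sub (1 : ℂ)).const_mul μ
  have hsk : Complex.sin k = 0 := by rw [← Complex.ofReal_sin, hk, Complex.ofReal_zero]
  refine exists_approximate_eigenvector hl hk0.ne' hk hkl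
    (f₁ := fun x => β * Complex.sin (k * x) + α * Complex.sin (l * (x + 1)))
    (f₂ := fun x => γ * Complex.sin (k * x) + δ * Complex.sinh (μ * (1 - x)))
    (g₁ := fun x => β * (k * Complex.cos (k * x)) + α * (Complex.cos (l * (x + 1)) * l))
    (g₂ := fun x => γ * (k * Complex.cos (k * x)) + δ * (Complex.cosh (μ * (1 - x)) * -μ))
    ?_ ?_ ?_ ?_ ?_ ?_ ?_ ?_ (by positivity) ?_ ?_
  · exact fun x => ((hasDerivAt_sin_mul k x).const_mul β).add
      (((Complex.hasDerivAt_sin _).comp x (hshift x)).const_mul α)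
  · exact fun x => ((hasDerivAt_sin_mul k x).const_mul γ).add
      (((Complex.hasDerivAt_sinh _).comp x (hrefl x)).const_mul δ)
  · intro x
    have h := (((hasDerivAt_cos_mul k x).const_mul (k : ℂ)).const_mul β).add
      ((((Complex.hasDerivAt_cos _).comp x (hshift x)).mul_const (l : ℂ)).const_mul α)
    refine h.congr_deriv ?_
    linear_combination Complex.sin (k * x) * eβ
  · intro x
    have h := ((((hasDerivAt_cos_mul k x).const_mul (k : ℂ)).const_mul γ).add
      ((((Complex.hasDerivAt_cosh _).comp x (hrefl x)).mul_const (-μ)).const_mul δ)).const_mul D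
    refine h.congr_deriv ?_
    linear_combination Complex.sin (k * x) * eγ + δ * Complex.sinh (μ * (1 - x)) * hμ
  · simp [hsk]
  · simp [hsk]
  · simp [eδ]
  · simp only [Complex.ofReal_zero, mul_zero, Complex.cos_zero, mul_one, zero_add, sub_zero]
    have e1 : δ * Complex.cosh μ = α * Complex.sin l * (Complex.cosh μ / Complex.sinh μ) := by
      rw [← eδ]
      field_simp
    rw [hT] at eα
    linear_combination eα - D * μ * e1
  · intro x _
    refine (norm_add_le _ _).trans ?_
    rw [norm_mul, norm_mul, nβ]
    have h1 : ‖Complex.sin ((k : ℂ) * x)‖ ≤ 1 := by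
      rw [← Complex.ofReal_mul]
      exact norm_ofReal_sin_le _
    have h2 : ‖Complex.sin ((l : ℂ) * (x + 1))‖ ≤ 1 := by
      rw [← Complex.ofReal_one, ← Complex.ofReal_add, ← Complex.ofReal_mul]
      exact norm_ofReal_sin_le _
    have h3 := mul_le_of_le_one_right (one_div_pos.2 hE).le h1
    have h4 := mul_le_of_le_one_right (norm_nonneg α) h2
    linarith [norm_nonneg α]
  · intro x hx
    refine (norm_add_le _ _).trans ?_
    rw [norm_mul γ]
    have h1 : ‖Complex.sin ((k : ℂ) * x)‖ ≤ 1 := by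
      rw [← Complex.ofReal_mul]
      exact norm_ofReal_sin_le _
    have h3 := mul_le_of_le_one_right (norm_nonneg γ) h1
    linarith [nδ x hx]

/-- If the semigroup is exponentially stable, then `2√c n π` stays close to the resonances of the
first wave. -/
theorem isBigO_sin_of_expStable (hc : 1 < p.c) {S : C0Semigroup (Energy p)}
    (hS : S.HasGenerator (waveOp p)) (h : S.ExpStable) :
    (fun n : ℕ => Real.sin (2 * √p.c * n * Real.pi)) =O[atTop]
      fun n : ℕ => (n : ℝ) ^ (-(1 / 2) : ℝ) := by
  obtain ⟨K, hK0, hK⟩ := h.exists_norm_le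
  have hd := p.d_pos
  have hπ := Real.pi_pos
  have hc0 := p.c_pos
  have hsc : 1 < √p.c := by
    rw [Real.lt_sqrt zero_le_one]
    simpa using hc
  have hsq : √p.c ^ 2 = p.c := Real.sq_sqrt hc0.le
  have hc1 : 0 < p.c - 1 := by linarith
  -- `C / k` is `K` times the residual bound after inserting `l = √c k` and `l² - k² = (c - 1) k²`.
  -- Once `k > C` it is below `1 ≤ ‖y‖`.
  set C : ℝ := K * (2 * (√p.c / (p.c - 1) + 2 * (2 + 1 / (p.c - 1)))) with hC
  have hlim : Tendsto (fun n : ℕ => 2 * √p.c * (n : ℝ) * Real.pi) atTop atTop :=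
    (tendsto_natCast_atTop_atTop.const_mul_atTop (by positivity)).atTop_mul_const hπ
  have hlim2 : Tendsto (fun n : ℕ => 2 * (n : ℝ) * Real.pi) atTop atTop :=
    (tendsto_natCast_atTop_atTop.const_mul_atTop (by positivity)).atTop_mul_const hπ
  refine IsBigO.of_bound (4 / √(2 * √p.c * Real.pi * p.d)) ?_
  filter_upwards [hlim.eventually_ge_atTop (1 / p.d),
    hlim.eventually_ge_atTop (4 * p.d + 2 / p.d), hlim2.eventually_gt_atTop C,
    hlim2.eventually_gt_atTop 0] with n h1 h2 h3 h4
  -- Only the even multiples of `π` are used, so that `l = √c k` is the argument of the sine in the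
  -- hypothesis.
  set k : ℝ := 2 * (n : ℝ) * Real.pi with hk
  set l : ℝ := 2 * √p.c * (n : ℝ) * Real.pi with hl
  have hlk : l = √p.c * k := by rw [hl, hk]; ring
  have hl0 : 0 < l := by rw [hlk]; positivity
  have hn : (0 : ℝ) < n := by
    have h5 : 0 < (n : ℝ) * (2 * Real.pi) := by
      rw [hk] at h4
      linarith
    exact pos_of_mul_pos_left h5 (by positivity)
  have hsin : Real.sin k = 0 := by
    have := Real.sin_nat_mul_pi (2 * n)
    push_cast at this
    exact this
  have hlt : √(l * p.d) * |Real.sin l| < 4 := by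
    by_contra! hs
    obtain ⟨y, z, hyz, hy, hz⟩ := exists_approximate_eigenvector_of_sin (p := p) (k := k) (l := l)
      h4 (by rw [hlk, mul_pow √p.c, hsq]) (by rw [hlk]; exact lt_mul_of_one_lt_left h4 hsc) hsin
      (by rwa [← div_le_iff₀ hd]) h2 hs
    have h5 := hK _ hS y z hyz l
    have e : K * (l * (2 * (1 / (l ^ 2 - k ^ 2) + 2 * ((2 / k + k / (l ^ 2 - k ^ 2)) / l)))) =
        C / k := by
      have e1 : l ^ 2 - k ^ 2 = (p.c - 1) * k ^ 2 := by
        rw [hlk, mul_pow √p.c, hsq]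
        ring
      rw [e1, hC]
      have hne := hc1.ne'
      have hl0' := hl0.ne'
      have hk0' := h4.ne'
      field_simp
      rw [hlk]
      ring
    have h6 := mul_le_mul_of_nonneg_left hz hK0
    rw [e] at h6
    have h7 : C / k < 1 := (div_lt_one h4).2 h3
    linarith
  -- Converts the resonance condition `√(l d) |sin l| < 4` into decay of order `n^{-1/2}` with the
  -- constant announced above.
  have e1 : √(l * p.d) = √(2 * √p.c * Real.pi * p.d) * √(n : ℝ) := by
    rw [← Real.sqrt_mul (by positivity)]
    congr 1
    rw [hl]
    ring
  have e2 : (n : ℝ) ^ (-(1 / 2) : ℝ) = (√(n : ℝ))⁻¹ := by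
    rw [Real.rpow_neg hn.le, Real.sqrt_eq_rpow]
  rw [e2, Real.norm_eq_abs, norm_inv, Real.norm_of_nonneg (Real.sqrt_nonneg _), ← div_eq_mul_inv,
    div_div, ← e1, le_div_iff₀ (Real.sqrt_pos.2 (by positivity)), mul_comm]
  exact hlt.le

end Instability

end KVWave

end

/-- If `c > 1` and `sin(2√c nπ)` is not `O(n^{-1/2})`, then the operator `𝒜` generates a
`C₀`-semigroup on the energy space, and the semigroup generated by `𝒜` is not exponentially
stable. -/
theorem theorem3p1 (p : KVWave.Params) (hc : 1 < p.c)
    (hsin : ¬ (fun n : ℕ => Real.sin (2 * √p.c * n * Real.pi)) =O[atTop]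
      fun n : ℕ => (n : ℝ) ^ (-(1 / 2) : ℝ)) :
    (∃ S : KVWave.C0Semigroup (KVWave.Energy p), S.HasGenerator (KVWave.waveOp p)) ∧
    ∀ S : KVWave.C0Semigroup (KVWave.Energy p), S.HasGenerator (KVWave.waveOp p) →
      ¬ S.ExpStable := by
  exact ⟨KVWave.exists_semigroup_waveOp p, fun _ hS h =>
    hsin (KVWave.isBigO_sin_of_expStable hc hS h)⟩
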